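/- Let $n,d\ge 1$, $\sigma>0$, $\rho\ge 0$ and let $X_1,\dots,X_n\sim N(\mu_P,\sigma^2 I_d)$ and $Y_1,\dots,Y_n\sim N(\mu_Q,\sigma^2 I_d)$ be independent samples with unknown means $\mu_P,\mu_Q\in\mathbb{R}^d$. Consider testing $H_0:\mu_P=\mu_Q$ against $H_1:\|\mu_P-\mu_Q\|=\rho$. For $a\in\mathbb{R}$ let $\mathcal{T}_{n,d,a}$ be the set of all measurable tests $\eta:\mathbb{R}^{n\times d}\times\mathbb{R}^{n\times d}\to\{0,1\}$ with $\mathbb{E}_{\mu,\mu}\,\eta\le a$ for every $\mu\in\mathbb{R}^d$, and define the minimax power at level $a$ by $$\beta_{n,d}(\rho,a,\sigma):=\sup_{\eta\in\mathcal{T}_{n,d,a}}\ \inf_{\|\mu_P-\mu_Q\|=\rho}\ \mathbb{E}_{\mu_P,\mu_Q}\,\eta .$$ Fix $\alpha\in(0,1)$, let $\Phi$ be the standard normal distribution function, let $z_\alpha$ be the $(1-\alpha)$-quantile of the standard normal distribution, and put $\Psi:=\rho/\sigma$. **Theorem.** As $d\to\infty$, $$\beta_{n,d}(\rho,\alpha,\sigma)=\Phi\left(-\frac{\sqrt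 d}{\sqrt{d+n\Psi^2}}\,z_\alpha+\frac{\Psi^2}{\sqrt{8d/n^2+8\Psi^2/n}}\right)+o(1),$$ where the $o(1)$ is uniform in $n\ge 1$, $\rho\ge 0$ and $\sigma>0$. The same holds for tests of level $\alpha+o(1)$. Precisely: for every $\varepsilon>0$ there are $\kappa>0$ and $D\in\mathbb{N}$ such that for all $d\ge D$, $n\ge 1$, $\rho\ge 0$, $\sigma>0$ and all $a$ with $|a-\alpha|\le\kappa$, the minimax power $\beta_{n,d}(\rho,a,\sigma)$ differs from the value of $\Phi$ displayed above (formed with $z_\alpha$) by at most $\varepsilon$. -/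

import Mathlib

open MeasureTheory ProbabilityTheory

noncomputable section

namespace MeanTest

/-- The Euclidean space `ℝ^d`. -/
abbrev Vec (d : ℕ) : Type := EuclideanSpace ℝ (Fin d)

/-- The two samples `((X_1, …, X_n), (Y_1, …, Y_n))` of vectors of `ℝ^d`. -/
abbrev Samples (n d : ℕ) : Type := (Fin n → Vec d) × (Fin n → Vec d)

/-- The spherical Gaussian law `N(m, σ² I_d)`. -/
def sphericalGaussian (d : ℕ) (σ : ℝ) (m : Vec d) : Measure (Vec d) :=
  multivariateGaussian m (σ ^ 2 • (1 : Matrix (Fin d) (Fin d) ℝ))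

/-- The joint law of `X_1, …, X_n ∼ N(p, σ² I_d)` and `Y_1, …, Y_n ∼ N(q, σ² I_d)`,
all of them independent. -/
def sampleLaw (n d : ℕ) (σ : ℝ) (p q : Vec d) : Measure (Samples n d) :=
  (Measure.pi fun _ : Fin n => sphericalGaussian d σ p).prod
    (Measure.pi fun _ : Fin n => sphericalGaussian d σ q)

/-- The rejection probability `𝔼 η` of `η` when the two means are `p` and `q`. -/
def rejectionProb {n d : ℕ} (σ : ℝ) (η : Samples n d → ℝ) (p q : Vec d) : ℝ :=
  ∫ z, η z ∂(sampleLaw n d σ p q)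

/-- The (measurable) tests with values in `{0, 1}` whose type-I error is at most `a` under the
null hypothesis that the two means are equal, whatever their common value. -/
def levelTests (n d : ℕ) (σ a : ℝ) : Set (Samples n d → ℝ) :=
  {η | Measurable η ∧ (∀ z, η z = 0 ∨ η z = 1) ∧ ∀ m : Vec d, rejectionProb σ η m m ≤ a}

/-- The alternative: the pairs of means whose difference lies on the sphere `S_d(ρ)`. -/
def alternative (d : ℕ) (ρ : ℝ) : Set (Vec d × Vec d) :=
  {θ | θ.1 - θ.2 ∈ Metric.sphere (0 : Vec d) ρ}

/-- The minimax power at level `a`: the supremum over all tests of level `a` of the smallest power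
over the alternative. -/
def minimaxPower (n d : ℕ) (ρ a σ : ℝ) : ℝ :=
  ⨆ η : levelTests n d σ a, ⨅ θ : alternative d ρ, rejectionProb σ η.1 θ.1.1 θ.1.2

/-- The standard normal distribution function `Φ`. -/
def stdNormalCdf (x : ℝ) : ℝ := cdf (gaussianReal 0 1) x

/-- `z_α`, the `(1 - α)`-quantile of the standard normal law. -/
def upperQuantile (α : ℝ) : ℝ := sInf {x : ℝ | 1 - α ≤ stdNormalCdf x}

/-- The approximate power, as a function of the signal-to-noise ratio `Ψ`. -/
def limitPower (n d : ℕ) (α Ψ : ℝ) : ℝ :=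
  stdNormalCdf (-(√(d : ℝ) / √((d : ℝ) + n * Ψ ^ 2)) * upperQuantile α +
    Ψ ^ 2 / √(8 * (d : ℝ) / (n : ℝ) ^ 2 + 8 * Ψ ^ 2 / n))

end MeanTest

end

/-!
Reject when `‖S‖² > x`, where `S` is the difference of the sample means scaled to have identity
covariance. Its mean `v` has squared norm `nΨ² / 2`, so `‖S‖²` is noncentral `χ²` with `d` degrees
of freedom. Rotating `v` onto the diagonal turns `‖S‖²` into a sum of `d` i.i.d. variables; once
standardized these have absolute third moment bounded uniformly in `v`, so Lindeberg's replacement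
method gives a normal approximation that is uniform in `v` and `x`.

No test does better. Against the prior putting opposite means `±u / 2` uniformly over a sphere, the
likelihood ratio depends on the data through `S` alone, and by rotation invariance it is an
increasing function of `‖S‖`; by Neyman–Pearson the test above is then optimal on average. The
minimax power at level `a` hence lies between the powers of the tests with critical values
`x = d + √(2d) (z_α ± ε / 2)`, whose levels enclose `a` for large `d`.
-/

open scoped ENNReal RealInnerProductSpace

noncomputable section

namespace MeanTest

section Lindeberg

lemma abs_sub_taylor_sum_le {f : ℝ → ℝ} {n : ℕ} {K : ℝ} (hf : ContDiff ℝ (n + 1) f)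
    (hK : ∀ x, |iteratedDeriv (n + 1) f x| ≤ K) (x h : ℝ) :
    |f (x + h) - ∑ k ∈ Finset.range (n + 1), iteratedDeriv k f x * h ^ k / k.factorial| ≤
      K * |h| ^ (n + 1) / (n + 1).factorial := by
  rcases eq_or_ne h 0 with rfl | hh
  · simp [Finset.sum_range_succ']
  have hne : x ≠ x + h := by simpa using hh
  obtain ⟨y, -, hy⟩ := taylor_mean_remainder_lagrange_iteratedDeriv hne hf.contDiffOn
  have hsum : taylorWithinEval f n (Set.uIcc x (x + h)) x (x + h) =
      ∑ k ∈ Finset.range (n + 1), iteratedDeriv k f x * h ^ k / k.factorial := by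
    rw [taylor_within_apply]
    refine Finset.sum_congr rfl fun k hk => ?_
    have hkn : (k : WithTop ℕ∞) ≤ n + 1 := by
      exact_mod_cast (Finset.mem_range.1 hk).le
    rw [iteratedDerivWithin_eq_iteratedDeriv (uniqueDiffOn_uIcc hne) (hf.of_le hkn).contDiffAt
      Set.left_mem_uIcc, add_sub_cancel_left, smul_eq_mul]
    ring
  rw [← hsum, hy, add_sub_cancel_left, abs_div, abs_mul, abs_pow, Nat.abs_cast]
  gcongr
  exact hK y

/-- The measure `μ` on the line has mean zero and second moment one. A finite third absolute
moment, on which the rate in Lindeberg's method depends, is included. -/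
structure IsStandardized (μ : Measure ℝ) : Prop where
  memLp : MemLp id 3 μ
  integral_id : ∫ x, x ∂μ = 0
  integral_sq : ∫ x, x ^ 2 ∂μ = 1

namespace IsStandardized

variable {μ ν : Measure ℝ}

lemma integrable_abs_cube (hμ : IsStandardized μ) : Integrable (fun x => |x| ^ 3) μ :=
  hμ.memLp.integrable_norm_pow (p := 3) (by norm_num)

variable [IsProbabilityMeasure μ] [IsProbabilityMeasure ν]

lemma integrable_id (hμ : IsStandardized μ) : Integrable (fun x => x) μ :=
  hμ.memLp.integrable (by norm_num)

lemma integrable_sq (hμ : IsStandardized μ) : Integrable (fun x => x ^ 2) μ :=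
  (hμ.memLp.mono_exponent (by norm_num)).integrable_sq

lemma integrable_quadratic (hμ : IsStandardized μ) (a b c : ℝ) :
    Integrable (fun x => a + b * x + c * x ^ 2) μ :=
  ((integrable_const a).add (hμ.integrable_id.const_mul b)).add (hμ.integrable_sq.const_mul c)

lemma integral_quadratic (hμ : IsStandardized μ) (a b c : ℝ) :
    ∫ x, (a + b * x + c * x ^ 2) ∂μ = a + c := by
  have hlinear : Integrable (fun x => a + b * x) μ :=
    (integrable_const a).add (hμ.integrable_id.const_mul b)
  rw [integral_add hlinear (hμ.integrable_sq.const_mul c),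
    integral_add (integrable_const a) (hμ.integrable_id.const_mul b), integral_const_mul,
    integral_const_mul, hμ.integral_id, hμ.integral_sq]
  simp

lemma abs_integral_comp_add_mul_sub_le (hμ : IsStandardized μ) {f : ℝ → ℝ} {B K : ℝ}
    (hf : ContDiff ℝ 3 f) (hB : ∀ x, |f x| ≤ B) (hK : ∀ x, |iteratedDeriv 3 f x| ≤ K) (y s : ℝ) :
    |∫ x, f (y + s * x) ∂μ - (f y + iteratedDeriv 2 f y / 2 * s ^ 2)| ≤
      K * |s| ^ 3 / 6 * ∫ x, |x| ^ 3 ∂μ := by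
  have hfi : Integrable (fun x => f (y + s * x)) μ :=
    Integrable.of_bound (hf.continuous.comp (by fun_prop)).aestronglyMeasurable B
      (Filter.Eventually.of_forall fun x => hB _)
  rw [← hμ.integral_quadratic (f y) (deriv f y * s),
    ← integral_sub hfi (hμ.integrable_quadratic _ _ _), ← integral_const_mul,
    ← Real.norm_eq_abs]
  refine norm_integral_le_of_norm_le (hμ.integrable_abs_cube.const_mul _)
    (Filter.Eventually.of_forall fun x => ?_)
  have htaylor := abs_sub_taylor_sum_le (n := 2) (by exact_mod_cast hf) hK y (s * x)
  simp only [Finset.sum_range_succ, Finset.sum_range_zero, iteratedDeriv_zero, iteratedDeriv_one]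
    at htaylor
  refine (le_of_eq ?_).trans (htaylor.trans_eq ?_)
  · rw [Real.norm_eq_abs]
    congr 1
    norm_num [Nat.factorial]
    ring
  · norm_num [Nat.factorial, abs_mul, mul_pow]
    ring

lemma abs_integral_comp_add_mul_sub_integral_le (hμ : IsStandardized μ) (hν : IsStandardized ν)
    {f : ℝ → ℝ} {B K : ℝ} (hf : ContDiff ℝ 3 f) (hB : ∀ x, |f x| ≤ B)
    (hK : ∀ x, |iteratedDeriv 3 f x| ≤ K) (y s : ℝ) :
    |∫ x, f (y + s * x) ∂μ - ∫ x, f (y + s * x) ∂ν| ≤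
      K * |s| ^ 3 / 6 * (∫ x, |x| ^ 3 ∂μ + ∫ x, |x| ^ 3 ∂ν) := by
  rw [mul_add]
  refine (abs_sub_le _ (f y + iteratedDeriv 2 f y / 2 * s ^ 2) _).trans (add_le_add ?_ ?_)
  · exact hμ.abs_integral_comp_add_mul_sub_le hf hB hK y s
  · rw [abs_sub_comm]
    exact hν.abs_integral_comp_add_mul_sub_le hf hB hK y s

end IsStandardized

section Telescoping

variable {E : Type*} [AddCommMonoid E] [MeasurableSpace E] [MeasurableAdd₂ E] {f : E → ℝ} {B : ℝ}

lemma integral_pi_succ_comp_add_sum (hf : Measurable f) (hB : ∀ x, |f x| ≤ B) {k : ℕ}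
    (μ : Fin (k + 1) → Measure E) [∀ i, IsProbabilityMeasure (μ i)] (y : E) :
    ∫ x, f (y + ∑ i, x i) ∂(Measure.pi μ) =
      ∫ a, ∫ x, f (y + a + ∑ i, x i) ∂(Measure.pi fun i : Fin k => μ i.succ) ∂(μ 0) := by
  have hsplit := (measurePreserving_piFinSuccAbove μ 0).symm
  rw [← hsplit.integral_comp (MeasurableEquiv.measurableEmbedding _), integral_prod]
  · simp [Fin.sum_univ_succ, MeasurableEquiv.piFinSuccAbove, add_assoc]
  · exact Integrable.of_bound (Measurable.aestronglyMeasurable (by fun_prop)) B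
      (Filter.Eventually.of_forall fun x => hB _)

lemma abs_integral_pi_comp_add_sum_sub_le (hf : Measurable f) (hB : ∀ x, |f x| ≤ B) {k : ℕ}
    (μ ν : Fin k → Measure E) [∀ i, IsProbabilityMeasure (μ i)] [∀ i, IsProbabilityMeasure (ν i)]
    {δ : Fin k → ℝ} (hδ : ∀ i y, |∫ x, f (y + x) ∂(μ i) - ∫ x, f (y + x) ∂(ν i)| ≤ δ i) (y : E) :
    |∫ x, f (y + ∑ i, x i) ∂(Measure.pi μ) - ∫ x, f (y + ∑ i, x i) ∂(Measure.pi ν)| ≤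
      ∑ i, δ i := by
  induction k generalizing y with
  | zero => simp
  | succ k ih =>
    set P := Measure.pi fun i : Fin k => μ i.succ
    set Q := Measure.pi fun i : Fin k => ν i.succ
    have hprod (κ : Measure E) [IsProbabilityMeasure κ] (κ' : Measure (Fin k → E))
        [IsProbabilityMeasure κ'] :
        Integrable (Function.uncurry fun a x => f (y + a + ∑ i, x i)) (κ.prod κ') :=
      Integrable.of_bound (Measurable.aestronglyMeasurable (hf.comp (by fun_prop))) B
        (Filter.Eventually.of_forall fun x => hB _)
    have hright (κ : Measure E) [IsProbabilityMeasure κ] :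
        Integrable (fun x => ∫ a, f (y + a + ∑ i, x i) ∂κ) Q := (hprod κ Q).integral_prod_right
    have hleft (κ : Measure (Fin k → E)) [IsProbabilityMeasure κ] :
        Integrable (fun a => ∫ x, f (y + a + ∑ i, x i) ∂κ) (μ 0) :=
      (hprod (μ 0) κ).integral_prod_left
    have hhead : |∫ a, ∫ x, f (y + a + ∑ i, x i) ∂Q ∂(μ 0) -
        ∫ a, ∫ x, f (y + a + ∑ i, x i) ∂Q ∂(ν 0)| ≤ δ 0 := by
      rw [integral_integral_swap (hprod _ _), integral_integral_swap (hprod _ _),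
        ← integral_sub (hright (μ 0)) (hright (ν 0)), ← Real.norm_eq_abs]
      refine (norm_integral_le_of_norm_le_const (C := δ 0)
        (Filter.Eventually.of_forall fun x => ?_)).trans_eq (by simp)
      simpa [add_right_comm] using hδ 0 (y + ∑ i, x i)
    have htail : |∫ a, ∫ x, f (y + a + ∑ i, x i) ∂P ∂(μ 0) -
        ∫ a, ∫ x, f (y + a + ∑ i, x i) ∂Q ∂(μ 0)| ≤ ∑ i : Fin k, δ i.succ := by
      rw [← integral_sub (hleft P) (hleft Q), ← Real.norm_eq_abs]
      exact (norm_integral_le_of_norm_le_const (Filter.Eventually.of_forall fun a =>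
        ih _ _ (fun i => hδ i.succ) (y + a))).trans_eq (by simp)
    rw [integral_pi_succ_comp_add_sum hf hB, integral_pi_succ_comp_add_sum hf hB,
      Fin.sum_univ_succ, add_comm (δ 0)]
    exact (abs_sub_le _ _ _).trans (add_le_add htail hhead)

end Telescoping

/-- The law of `(ξ₁ + ⋯ + ξ_d) / √d` for independent `ξ₁, …, ξ_d` of law `μ`. -/
def normalizedSumLaw (μ : Measure ℝ) (d : ℕ) : Measure ℝ :=
  (Measure.pi fun _ : Fin d => μ).map fun x => (∑ i, x i) / √d

instance (μ : Measure ℝ) [IsProbabilityMeasure μ] (d : ℕ) :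
    IsProbabilityMeasure (normalizedSumLaw μ d) :=
  Measure.isProbabilityMeasure_map (by fun_prop)

lemma integral_normalizedSumLaw {μ : Measure ℝ} {f : ℝ → ℝ} (hf : Measurable f) (d : ℕ) :
    ∫ x, f x ∂(normalizedSumLaw μ d) =
      ∫ x, f ((√d)⁻¹ * ∑ i, x i) ∂(Measure.pi fun _ : Fin d => μ) := by
  rw [normalizedSumLaw, integral_map (by fun_prop) hf.aestronglyMeasurable]
  simp only [div_eq_inv_mul]

lemma IsStandardized.abs_integral_normalizedSumLaw_sub_le {μ ν : Measure ℝ}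
    [IsProbabilityMeasure μ] [IsProbabilityMeasure ν] (hμ : IsStandardized μ)
    (hν : IsStandardized ν) {f : ℝ → ℝ} {B K : ℝ} (hf : ContDiff ℝ 3 f) (hB : ∀ x, |f x| ≤ B)
    (hK : ∀ x, |iteratedDeriv 3 f x| ≤ K) {d : ℕ} (hd : 0 < d) :
    |∫ x, f x ∂(normalizedSumLaw μ d) - ∫ x, f x ∂(normalizedSumLaw ν d)| ≤
      K / (6 * √d) * (∫ x, |x| ^ 3 ∂μ + ∫ x, |x| ^ 3 ∂ν) := by
  set s : ℝ := (√d)⁻¹ with hs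
  have hfm : Measurable fun x => f (s * x) := hf.continuous.measurable.comp (by fun_prop)
  have hswap := abs_integral_pi_comp_add_sum_sub_le (k := d) hfm (fun x => hB (s * x))
    (fun _ => μ) (fun _ => ν) (δ := fun _ => K * |s| ^ 3 / 6 * (∫ x, |x| ^ 3 ∂μ + ∫ x, |x| ^ 3 ∂ν))
    (fun _ y => by
      simpa only [mul_add] using
        hμ.abs_integral_comp_add_mul_sub_integral_le hν hf hB hK (s * y) s) 0
  simp only [zero_add, Finset.sum_const, Finset.card_univ, Fintype.card_fin, nsmul_eq_mul] at hswap
  rw [integral_normalizedSumLaw hf.continuous.measurable,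
    integral_normalizedSumLaw hf.continuous.measurable]
  refine hswap.trans_eq ?_
  have : 0 < √(d : ℝ) := by positivity
  have hsq : √(d : ℝ) ^ 2 = d := Real.sq_sqrt (Nat.cast_nonneg d)
  rw [hs, abs_of_pos (by positivity)]
  field_simp
  rw [hsq]
  ring

/-- A smooth approximation of the indicator function of `(t, ∞)`, rising from `0` to `1` on
`[t, t + η]`. -/
def smoothStep (t η x : ℝ) : ℝ := Real.smoothTransition ((x - t) / η)

lemma contDiff_smoothStep (t η : ℝ) (n : ℕ) : ContDiff ℝ n (smoothStep t η) :=
  Real.smoothTransition.contDiff.comp (by fun_prop)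

lemma abs_smoothStep_le_one (t η x : ℝ) : |smoothStep t η x| ≤ 1 := by
  rw [smoothStep, abs_of_nonneg (Real.smoothTransition.nonneg _)]
  exact Real.smoothTransition.le_one _

lemma exists_abs_iteratedDeriv_smoothTransition_le {n : ℕ} (hn : n ≠ 0) :
    ∃ K, ∀ x, |iteratedDeriv n Real.smoothTransition x| ≤ K := by
  have hc : Continuous (iteratedDeriv n Real.smoothTransition) :=
    (Real.smoothTransition.contDiff (n := n)).continuous_iteratedDeriv n le_rfl
  have hconst {c x : ℝ} (h : Real.smoothTransition =ᶠ[nhds x] fun _ => c) :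
      iteratedDeriv n Real.smoothTransition x = 0 := by
    rw [h.iteratedDeriv_eq, iteratedDeriv_const, if_neg hn]
  obtain ⟨K, hK⟩ := (isCompact_Icc (a := (0 : ℝ)) (b := 1)).exists_bound_of_continuousOn
    hc.continuousOn
  have hK0 : 0 ≤ K := (norm_nonneg _).trans (hK 0 (by simp))
  refine ⟨K, fun x => ?_⟩
  rcases lt_or_ge x 0 with hx0 | hx0
  · rw [hconst (c := 0), abs_zero]
    · exact hK0
    · filter_upwards [Iio_mem_nhds hx0] with y hy
        using Real.smoothTransition.zero_of_nonpos (le_of_lt hy)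
  rcases lt_or_ge 1 x with hx1 | hx1
  · rw [hconst (c := 1), abs_zero]
    · exact hK0
    · filter_upwards [Ioi_mem_nhds hx1] with y hy
        using Real.smoothTransition.one_of_one_le (le_of_lt hy)
  · exact hK x ⟨hx0, hx1⟩

lemma iteratedDeriv_smoothStep (t η : ℝ) (n : ℕ) (x : ℝ) :
    iteratedDeriv n (smoothStep t η) x =
      η⁻¹ ^ n * iteratedDeriv n Real.smoothTransition ((x - t) / η) := by
  have hscale := iteratedDeriv_comp_const_mul
    (Real.smoothTransition.contDiff (n := n) : ContDiff ℝ n Real.smoothTransition) η⁻¹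
  have hstep : smoothStep t η = fun x => Real.smoothTransition (η⁻¹ * (x - t)) := by
    ext x
    rw [smoothStep, div_eq_inv_mul]
  rw [hstep, iteratedDeriv_comp_sub_const n (fun x => Real.smoothTransition (η⁻¹ * x)) t, hscale,
    div_eq_inv_mul]

lemma integral_smoothStep_le (μ : Measure ℝ) [IsFiniteMeasure μ] (t : ℝ) {η : ℝ} (hη : 0 ≤ η) :
    ∫ x, smoothStep t η x ∂μ ≤ μ.real (Set.Ioi t) := by
  rw [← integral_indicator_one measurableSet_Ioi]
  refine integral_mono (Integrable.of_bound
    (contDiff_smoothStep t η 0).continuous.aestronglyMeasurable 1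
    (Filter.Eventually.of_forall (abs_smoothStep_le_one t η)))
    ((integrable_const 1).indicator measurableSet_Ioi) fun x => ?_
  by_cases hx : t < x
  · simpa [hx] using (le_abs_self _).trans (abs_smoothStep_le_one t η x)
  · rw [Set.indicator_of_notMem (by simpa using hx)]
    exact (Real.smoothTransition.zero_of_nonpos
      (div_nonpos_of_nonpos_of_nonneg (by linarith) hη)).le

lemma measureReal_Ioi_le_integral_smoothStep (μ : Measure ℝ) [IsFiniteMeasure μ] (t : ℝ) {η : ℝ}
    (hη : 0 < η) : μ.real (Set.Ioi (t + η)) ≤ ∫ x, smoothStep t η x ∂μ := by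
  rw [← integral_indicator_one measurableSet_Ioi]
  refine integral_mono ((integrable_const 1).indicator measurableSet_Ioi) (Integrable.of_bound
    (contDiff_smoothStep t η 0).continuous.aestronglyMeasurable 1
    (Filter.Eventually.of_forall (abs_smoothStep_le_one t η))) fun x => ?_
  by_cases hx : t + η < x
  · rw [Set.indicator_of_mem (Set.mem_Ioi.2 hx), smoothStep,
      Real.smoothTransition.one_of_one_le ((one_le_div hη).2 (by linarith)), Pi.one_apply]
  · rw [Set.indicator_of_notMem (by simpa using hx)]
    exact Real.smoothTransition.nonneg _

lemma measureReal_Ioi_sub_measureReal_Ioi (μ : Measure ℝ) [IsFiniteMeasure μ] {a b : ℝ}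
    (hab : a ≤ b) : μ.real (Set.Ioi a) - μ.real (Set.Ioi b) = μ.real (Set.Ioc a b) := by
  rw [← Set.Ioc_union_Ioi_eq_Ioi hab,
    measureReal_union (Set.Ioc_disjoint_Ioi le_rfl) measurableSet_Ioi, add_sub_cancel_right]

lemma abs_measureReal_Ioi_sub_le_of_smoothStep {μ ν : Measure ℝ} [IsFiniteMeasure μ]
    [IsFiniteMeasure ν] {η δ δ' : ℝ} (hη : 0 < η)
    (hδ : ∀ t, |∫ x, smoothStep t η x ∂μ - ∫ x, smoothStep t η x ∂ν| ≤ δ)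
    (hδ' : ∀ t, ν.real (Set.Ioc t (t + η)) ≤ δ') (t : ℝ) :
    |μ.real (Set.Ioi t) - ν.real (Set.Ioi t)| ≤ δ + δ' := by
  have hadd : t - η + η = t := sub_add_cancel t η
  rw [abs_le]
  constructor
  · have hμ := integral_smoothStep_le μ t hη.le
    have hν := measureReal_Ioi_le_integral_smoothStep ν t hη
    have hsub := measureReal_Ioi_sub_measureReal_Ioi ν (le_add_of_nonneg_right hη.le : t ≤ t + η)
    linarith [(abs_le.1 (hδ t)).1, hδ' t]
  · have hμ := measureReal_Ioi_le_integral_smoothStep μ (t - η) hη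
    have hν := integral_smoothStep_le ν (t - η) hη.le
    have hsub := measureReal_Ioi_sub_measureReal_Ioi ν (sub_le_self t hη.le)
    have hmod := hδ' (t - η)
    rw [hadd] at hμ hmod
    linarith [(abs_le.1 (hδ (t - η))).2]

end Lindeberg

section GaussianReal

open scoped NNReal

lemma gaussianPDFReal_le (m : ℝ) (v : ℝ≥0) (x : ℝ) :
    gaussianPDFReal m v x ≤ (√(2 * Real.pi * v))⁻¹ := by
  rw [gaussianPDFReal_def]
  refine mul_le_of_le_one_right (by positivity) (Real.exp_le_one_iff.2 ?_)
  exact div_nonpos_of_nonpos_of_nonneg (neg_nonpos.2 (sq_nonneg _)) (by positivity)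

lemma gaussianReal_le_smul_volume (m : ℝ) {v : ℝ≥0} (hv : v ≠ 0) :
    gaussianReal m v ≤ ENNReal.ofReal (√(2 * Real.pi * v))⁻¹ • volume := by
  rw [gaussianReal_of_var_ne_zero m hv, ← withDensity_const]
  exact withDensity_mono (Filter.Eventually.of_forall fun x =>
    ENNReal.ofReal_le_ofReal (gaussianPDFReal_le m v x))

lemma gaussianReal_real_Ioc_le (m : ℝ) {v : ℝ≥0} (hv : v ≠ 0) {a b : ℝ} (hab : a ≤ b) :
    (gaussianReal m v).real (Set.Ioc a b) ≤ (√(2 * Real.pi * v))⁻¹ * (b - a) := by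
  refine ENNReal.toReal_le_of_le_ofReal (mul_nonneg (by positivity) (sub_nonneg.2 hab)) ?_
  refine (gaussianReal_le_smul_volume m hv _).trans_eq ?_
  rw [Measure.smul_apply, Real.volume_Ioc, smul_eq_mul, ENNReal.ofReal_mul (by positivity)]

lemma stdGaussianReal_real_Ioc_le {a b : ℝ} (hab : a ≤ b) :
    (gaussianReal 0 1).real (Set.Ioc a b) ≤ b - a := by
  refine (gaussianReal_real_Ioc_le 0 one_ne_zero hab).trans
    (mul_le_of_le_one_left (sub_nonneg.2 hab) (inv_le_one_of_one_le₀ (Real.one_le_sqrt.2 ?_)))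
  rw [NNReal.coe_one]
  linarith [Real.pi_gt_three]

lemma hasDerivAt_gaussianPDFReal (m : ℝ) (v : ℝ≥0) (x : ℝ) :
    HasDerivAt (gaussianPDFReal m v) (-((x - m) / v) * gaussianPDFReal m v x) x := by
  have hexponent : HasDerivAt (fun y => -(y - m) ^ 2 / (2 * v)) (-((x - m) / v)) x := by
    refine ((((hasDerivAt_id' x).sub_const m).pow 2).neg.div_const (2 * (v : ℝ))).congr_deriv ?_
    ring
  refine (hexponent.exp.const_mul (√(2 * Real.pi * v))⁻¹).congr_deriv ?_
  rw [gaussianPDFReal]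
  ring

lemma integrable_pow_gaussianReal (m : ℝ) (v : ℝ≥0) (k : ℕ) :
    Integrable (fun x => x ^ k) (gaussianReal m v) := by
  rcases eq_or_ne k 0 with rfl | hk
  · simp
  · refine (integrable_norm_iff (by fun_prop)).1 ?_
    simpa only [id_eq, norm_pow] using
      (memLp_id_gaussianReal (μ := m) (v := v) k).integrable_norm_pow hk

lemma integrable_pow_mul_gaussianPDFReal (m : ℝ) {v : ℝ≥0} (hv : v ≠ 0) (k : ℕ) :
    Integrable fun x => x ^ k * gaussianPDFReal m v x := by
  have hpow := integrable_pow_gaussianReal m v k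
  rw [gaussianReal_of_var_ne_zero m hv, integrable_withDensity_iff_integrable_smul'
    (measurable_gaussianPDF m v) (Filter.Eventually.of_forall fun _ => gaussianPDF_lt_top)] at hpow
  simpa only [toReal_gaussianPDF, smul_eq_mul, mul_comm] using hpow

lemma integral_pow_add_two_gaussianReal (v : ℝ≥0) (k : ℕ) :
    ∫ x, x ^ (k + 2) ∂(gaussianReal 0 v) = v * (k + 1) * ∫ x, x ^ k ∂(gaussianReal 0 v) := by
  rcases eq_or_ne v 0 with rfl | hv
  · simp
  have hv' : (v : ℝ) ≠ 0 := by exact_mod_cast hv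
  have hparts := integral_mul_deriv_eq_deriv_mul_of_integrable
    (u := fun x : ℝ => x ^ (k + 1)) (v := gaussianPDFReal 0 v)
    (fun x _ => by simpa using hasDerivAt_pow (k + 1) x)
    (fun x _ => hasDerivAt_gaussianPDFReal 0 v x)
    (((integrable_pow_mul_gaussianPDFReal 0 hv (k + 2)).const_mul (-(v : ℝ)⁻¹)).congr
      (Filter.Eventually.of_forall fun x => by simp only [Pi.mul_apply]; ring))
    (((integrable_pow_mul_gaussianPDFReal 0 hv k).const_mul (k + 1 : ℝ)).congr
      (Filter.Eventually.of_forall fun x => by simp only [Pi.mul_apply]; ring))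
    (integrable_pow_mul_gaussianPDFReal 0 hv (k + 1))
  rw [integral_gaussianReal_eq_integral_smul hv, integral_gaussianReal_eq_integral_smul hv]
  calc ∫ x, gaussianPDFReal 0 v x • x ^ (k + 2)
    _ = -v * ∫ x, x ^ (k + 1) * (-((x - 0) / v) * gaussianPDFReal 0 v x) := by
      rw [← integral_const_mul]
      refine integral_congr_ae (Filter.Eventually.of_forall fun x => ?_)
      simp only [smul_eq_mul]
      field_simp
      ring
    _ = v * ∫ x, (k + 1) * (gaussianPDFReal 0 v x • x ^ k) := by
      rw [hparts, neg_mul_neg]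
      simp only [smul_eq_mul, mul_comm (gaussianPDFReal 0 v _), mul_assoc]
    _ = v * (k + 1) * ∫ x, gaussianPDFReal 0 v x • x ^ k := by
      rw [integral_const_mul, mul_assoc]

lemma integral_pow_two_gaussianReal : ∫ x, x ^ 2 ∂(gaussianReal 0 1) = 1 := by
  simp [integral_pow_add_two_gaussianReal 1 0]

lemma integral_pow_three_gaussianReal : ∫ x, x ^ 3 ∂(gaussianReal 0 1) = 0 := by
  simp [integral_pow_add_two_gaussianReal 1 1]

lemma integral_pow_four_gaussianReal : ∫ x, x ^ 4 ∂(gaussianReal 0 1) = 3 := by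
  rw [integral_pow_add_two_gaussianReal 1 2, integral_pow_two_gaussianReal]
  norm_num

lemma isStandardized_gaussianReal : IsStandardized (gaussianReal 0 1) where
  memLp := memLp_id_gaussianReal 3
  integral_id := integral_id_gaussianReal
  integral_sq := integral_pow_two_gaussianReal

lemma gaussianReal_Ioi (t : ℝ) : (gaussianReal 0 1).real (Set.Ioi t) = stdNormalCdf (-t) := by
  have : NullSingletonClass (gaussianReal 0 1) := nullSingletonClass_gaussianReal one_ne_zero
  have hsymm : (gaussianReal 0 1).map (fun x => -x) = gaussianReal 0 1 := by
    rw [gaussianReal_map_neg, neg_zero]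
  rw [stdNormalCdf, cdf_eq_real, measureReal_congr Ioi_ae_eq_Ici, ← hsymm,
    map_measureReal_apply measurable_neg measurableSet_Iic, hsymm]
  simp

lemma stdNormalCdf_neg (x : ℝ) : stdNormalCdf (-x) = 1 - stdNormalCdf x := by
  rw [← gaussianReal_Ioi, stdNormalCdf, cdf_eq_real, ← Set.compl_Iic,
    probReal_compl_eq_one_sub measurableSet_Iic]

lemma stdNormalCdf_sub {x y : ℝ} (h : x ≤ y) :
    stdNormalCdf y - stdNormalCdf x = (gaussianReal 0 1).real (Set.Ioc x y) := by
  rw [stdNormalCdf, stdNormalCdf, cdf_eq_real, cdf_eq_real, ← Set.Iic_union_Ioc_eq_Iic h,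
    measureReal_union (Set.Iic_disjoint_Ioc le_rfl) measurableSet_Ioc, add_sub_cancel_left]

lemma lipschitzWith_stdNormalCdf : LipschitzWith 1 stdNormalCdf :=
  LipschitzWith.of_le_add fun x y => by
    rw [Real.dist_eq]
    rcases le_total y x with h | h
    · rw [abs_of_nonneg (sub_nonneg.2 h)]
      linarith [stdNormalCdf_sub h, stdGaussianReal_real_Ioc_le h]
    · exact (monotone_cdf _ h).trans (le_add_of_nonneg_right (abs_nonneg _))

lemma strictMono_stdNormalCdf : StrictMono stdNormalCdf := fun x y h => by
  have hpos : 0 < (gaussianReal 0 1).real (Set.Ioc x y) := by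
    refine ENNReal.toReal_pos (fun hzero => ?_) (measure_ne_top _ _)
    have hvol := gaussianReal_absolutelyContinuous' 0 one_ne_zero hzero
    rw [Real.volume_Ioc, ENNReal.ofReal_eq_zero] at hvol
    linarith
  rwa [← stdNormalCdf_sub h.le, sub_pos] at hpos

lemma stdNormalCdf_upperQuantile {α : ℝ} (hα0 : 0 < α) (hα1 : α < 1) :
    stdNormalCdf (upperQuantile α) = 1 - α := by
  have hcont : Continuous stdNormalCdf := lipschitzWith_stdNormalCdf.continuous
  obtain ⟨x, hx⟩ : 1 - α ∈ Set.range stdNormalCdf := by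
    refine mem_range_of_exists_le_of_exists_ge hcont ?_ ?_
    · exact ((tendsto_cdf_atBot (gaussianReal 0 1)).eventually
        (ge_mem_nhds (sub_pos.2 hα1))).exists
    · exact ((tendsto_cdf_atTop (gaussianReal 0 1)).eventually
        (le_mem_nhds (sub_lt_self 1 hα0))).exists
  have hset : {y | 1 - α ≤ stdNormalCdf y} = Set.Ici x := by
    ext y
    rw [Set.mem_ofPred_eq, ← hx, strictMono_stdNormalCdf.le_iff_le, Set.mem_Ici]
  rw [upperQuantile, hset, csInf_Ici, hx]

lemma normalizedSumLaw_gaussianReal {d : ℕ} (hd : 0 < d) :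
    normalizedSumLaw (gaussianReal 0 1) d = gaussianReal 0 1 := by
  have hd' : (d : ℝ) ≠ 0 := by exact_mod_cast hd.ne'
  have hsum : (Measure.pi fun _ : Fin d => gaussianReal 0 1).map (fun x => ∑ i, x i) =
      gaussianReal 0 d := by
    refine Measure.ext_of_charFun (funext fun t => ?_)
    rw [charFun_map_sum_pi_eq_prod, Finset.prod_const, Pi.pow_apply, charFun_gaussianReal,
      charFun_gaussianReal, ← Complex.exp_nat_mul]
    congr 1
    simp
    ring
  have hmap := Measure.map_map (μ := Measure.pi fun _ : Fin d => gaussianReal 0 1)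
    (f := fun x => ∑ i, x i) (g := fun x => x / √(d : ℝ)) (by fun_prop) (by fun_prop)
  rw [hsum, gaussianReal_map_div_const] at hmap
  refine hmap.symm.trans ?_
  congr
  · simp
  · ext
    simp [hd']

end GaussianReal

section BerryEsseen

lemma IsStandardized.exists_abs_normalizedSumLaw_Ioi_sub_le : ∃ K : ℝ, ∀ (μ : Measure ℝ)
    [IsProbabilityMeasure μ], IsStandardized μ → ∀ d : ℕ, 0 < d → ∀ η t : ℝ, 0 < η →
    |(normalizedSumLaw μ d).real (Set.Ioi t) - stdNormalCdf (-t)| ≤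
      K / (η ^ 3 * √d) * (∫ x, |x| ^ 3 ∂μ + ∫ x, |x| ^ 3 ∂(gaussianReal 0 1)) + η := by
  obtain ⟨K, hK⟩ := exists_abs_iteratedDeriv_smoothTransition_le (n := 3) (by norm_num)
  refine ⟨K / 6, fun μ _ hμ d hd η t hη => ?_⟩
  rw [← gaussianReal_Ioi]
  refine abs_measureReal_Ioi_sub_le_of_smoothStep hη (fun t => ?_) (fun t => ?_) t
  · have hbound (x : ℝ) : |iteratedDeriv 3 (smoothStep t η) x| ≤ η⁻¹ ^ 3 * K := by
      rw [iteratedDeriv_smoothStep, abs_mul, abs_of_pos (by positivity)]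
      gcongr
      exact hK _
    have hsmooth := hμ.abs_integral_normalizedSumLaw_sub_le isStandardized_gaussianReal
      (contDiff_smoothStep t η 3) (abs_smoothStep_le_one t η) hbound hd
    rw [normalizedSumLaw_gaussianReal hd] at hsmooth
    refine hsmooth.trans_eq ?_
    congr 1
    field_simp
  · simpa using stdGaussianReal_real_Ioc_le (le_add_of_nonneg_right hη.le : t ≤ t + η)

lemma IsStandardized.eventually_abs_normalizedSumLaw_Ioi_sub_le (M : ℝ) {ε : ℝ} (hε : 0 < ε) :
    ∀ᶠ d : ℕ in Filter.atTop, ∀ (μ : Measure ℝ) [IsProbabilityMeasure μ], IsStandardized μ →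
      ∫ x, |x| ^ 3 ∂μ ≤ M → ∀ t : ℝ,
      |(normalizedSumLaw μ d).real (Set.Ioi t) - stdNormalCdf (-t)| ≤ ε := by
  obtain ⟨K, hK⟩ := IsStandardized.exists_abs_normalizedSumLaw_Ioi_sub_le
  set S := M + ∫ x, |x| ^ 3 ∂(gaussianReal 0 1) with hS
  have hlim : Filter.Tendsto (fun d : ℕ => |K| / ((ε / 2) ^ 3 * √d) * S)
      Filter.atTop (nhds 0) := by
    have hsqrt : Filter.Tendsto (fun d : ℕ => (ε / 2) ^ 3 * √(d : ℝ)) Filter.atTop Filter.atTop :=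
      (Real.tendsto_sqrt_atTop.comp tendsto_natCast_atTop_atTop).const_mul_atTop (by positivity)
    simpa using (hsqrt.const_div_atTop |K|).mul_const S
  filter_upwards [hlim.eventually (ge_mem_nhds (half_pos hε)), Filter.eventually_gt_atTop 0]
    with d hd hd0 μ _ hμ hM t
  calc |(normalizedSumLaw μ d).real (Set.Ioi t) - stdNormalCdf (-t)|
    _ ≤ K / ((ε / 2) ^ 3 * √d) * (∫ x, |x| ^ 3 ∂μ + ∫ x, |x| ^ 3 ∂(gaussianReal 0 1)) + ε / 2 :=
      hK μ hμ d hd0 (ε / 2) t (half_pos hε)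
    _ ≤ |K| / ((ε / 2) ^ 3 * √d) * S + ε / 2 := by
      rw [hS]
      gcongr
      exact le_abs_self K
    _ ≤ ε := by linarith

end BerryEsseen

section NoncentralChiSq

/-- The standardization of `(ξ + m)²`, where `ξ` is a standard normal variable: `(ξ + m)²` has mean
`1 + m²` and variance `2 + 4m²`. -/
def stdShiftedSq (m x : ℝ) : ℝ := ((x + m) ^ 2 - (1 + m ^ 2)) / √(2 + 4 * m ^ 2)

lemma measurable_stdShiftedSq (m : ℝ) : Measurable (stdShiftedSq m) := by
  unfold stdShiftedSq
  fun_prop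

lemma abs_stdShiftedSq_le (m x : ℝ) : |stdShiftedSq m x| ≤ 2 * (1 + x ^ 2) := by
  have hpos : 0 < √(2 + 4 * m ^ 2) := by positivity
  have hone : 1 ≤ √(2 + 4 * m ^ 2) := Real.one_le_sqrt.2 (by nlinarith)
  have hm : |2 * m| ≤ √(2 + 4 * m ^ 2) := Real.abs_le_sqrt (by nlinarith)
  have hx : |x| ≤ 1 + x ^ 2 := by nlinarith [sq_abs x, sq_nonneg (|x| - 1), abs_nonneg x]
  rw [stdShiftedSq, abs_div, abs_of_pos hpos, div_le_iff₀ hpos]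
  calc |(x + m) ^ 2 - (1 + m ^ 2)|
    _ = |(x ^ 2 - 1) + 2 * m * x| := by congr 1; ring
    _ ≤ |x ^ 2 - 1| + |2 * m| * |x| := (abs_add_le _ _).trans_eq (by rw [abs_mul])
    _ ≤ 1 * (1 + x ^ 2) + √(2 + 4 * m ^ 2) * (1 + x ^ 2) := by
      gcongr
      exact abs_le.2 ⟨by nlinarith, by linarith⟩
    _ ≤ 2 * (1 + x ^ 2) * √(2 + 4 * m ^ 2) := by nlinarith [sq_nonneg x]

lemma integral_quartic_gaussianReal (a b c d e : ℝ) :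
    ∫ x, (a + b * x + c * x ^ 2 + d * x ^ 3 + e * x ^ 4) ∂(gaussianReal 0 1) = a + c + 3 * e := by
  have hquadratic := isStandardized_gaussianReal.integrable_quadratic a b c
  have hpow (k : ℕ) (r : ℝ) := (integrable_pow_gaussianReal 0 1 k).const_mul r
  have hcubic : Integrable (fun x => a + b * x + c * x ^ 2 + d * x ^ 3) (gaussianReal 0 1) :=
    hquadratic.add (hpow 3 d)
  rw [integral_add hcubic (hpow 4 e), integral_add hquadratic (hpow 3 d),
    isStandardized_gaussianReal.integral_quadratic, integral_const_mul, integral_const_mul,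
    integral_pow_three_gaussianReal, integral_pow_four_gaussianReal]
  ring

lemma integral_stdShiftedSq (m : ℝ) : ∫ x, stdShiftedSq m x ∂(gaussianReal 0 1) = 0 := by
  calc ∫ x, stdShiftedSq m x ∂(gaussianReal 0 1)
    _ = ∫ x, (-1 + 2 * m * x + 1 * x ^ 2) / √(2 + 4 * m ^ 2) ∂(gaussianReal 0 1) := by
      congr with x
      rw [stdShiftedSq]
      ring
    _ = 0 := by
      rw [integral_div, isStandardized_gaussianReal.integral_quadratic]
      norm_num

lemma integral_stdShiftedSq_sq (m : ℝ) : ∫ x, stdShiftedSq m x ^ 2 ∂(gaussianReal 0 1) = 1 := by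
  have hvar : 0 < 2 + 4 * m ^ 2 := by positivity
  calc ∫ x, stdShiftedSq m x ^ 2 ∂(gaussianReal 0 1)
    _ = ∫ x, (1 + -4 * m * x + (4 * m ^ 2 - 2) * x ^ 2 + 4 * m * x ^ 3 + 1 * x ^ 4) /
        (2 + 4 * m ^ 2) ∂(gaussianReal 0 1) := by
      congr with x
      rw [stdShiftedSq, div_pow, Real.sq_sqrt hvar.le]
      ring
    _ = 1 := by
      rw [integral_div, integral_quartic_gaussianReal, div_eq_one_iff_eq hvar.ne']
      ring

/-- The law of the standardized square of a normal variable with mean `m` and variance one. -/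
def stdShiftedSqLaw (m : ℝ) : Measure ℝ := (gaussianReal 0 1).map (stdShiftedSq m)

instance (m : ℝ) : IsProbabilityMeasure (stdShiftedSqLaw m) :=
  Measure.isProbabilityMeasure_map (measurable_stdShiftedSq m).aemeasurable

lemma integrable_one_add_sq_pow (c : ℝ) (k : ℕ) :
    Integrable (fun x => (c * (1 + x ^ 2)) ^ k) (gaussianReal 0 1) := by
  simp only [mul_pow, add_pow, ← pow_mul, one_pow, one_mul]
  exact (integrable_finsetSum _ fun i _ =>
    (integrable_pow_gaussianReal 0 1 _).mul_const _).const_mul _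

lemma isStandardized_stdShiftedSqLaw (m : ℝ) : IsStandardized (stdShiftedSqLaw m) where
  memLp := by
    have hmeas := measurable_stdShiftedSq m
    rw [stdShiftedSqLaw, memLp_map_measure_iff (by fun_prop) hmeas.aemeasurable,
      ← integrable_norm_rpow_iff (by fun_prop) (by norm_num) (by norm_num)]
    refine (integrable_one_add_sq_pow 2 3).mono' (hmeas.norm.pow_const _).aestronglyMeasurable
      (Filter.Eventually.of_forall fun x => ?_)
    have hpow := pow_le_pow_left₀ (abs_nonneg _) (abs_stdShiftedSq_le m x) 3
    simpa using hpow
  integral_id := by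
    rw [stdShiftedSqLaw, integral_map (measurable_stdShiftedSq m).aemeasurable (by fun_prop),
      integral_stdShiftedSq]
  integral_sq := by
    rw [stdShiftedSqLaw, integral_map (measurable_stdShiftedSq m).aemeasurable (by fun_prop),
      integral_stdShiftedSq_sq]

lemma integral_abs_cube_stdShiftedSqLaw_le (m : ℝ) :
    ∫ x, |x| ^ 3 ∂(stdShiftedSqLaw m) ≤ ∫ x, (2 * (1 + x ^ 2)) ^ 3 ∂(gaussianReal 0 1) := by
  rw [stdShiftedSqLaw, integral_map (measurable_stdShiftedSq m).aemeasurable (by fun_prop)]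
  exact integral_mono_of_nonneg (Filter.Eventually.of_forall fun x => by positivity)
    (integrable_one_add_sq_pow 2 3) (Filter.Eventually.of_forall fun x =>
      pow_le_pow_left₀ (abs_nonneg _) (abs_stdShiftedSq_le m x) 3)

lemma exists_linearIsometryEquiv_apply_eq {E : Type*} [NormedAddCommGroup E]
    [InnerProductSpace ℝ E] {v w : E} (h : ‖v‖ = ‖w‖) : ∃ L : E ≃ₗᵢ[ℝ] E, L v = w :=
  ⟨_, Submodule.reflection_sub h⟩

section Isometry

variable {E F : Type*} [NormedAddCommGroup E] [InnerProductSpace ℝ E] [FiniteDimensional ℝ E]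
  [MeasurableSpace E] [BorelSpace E] [NormedAddCommGroup F] [InnerProductSpace ℝ F]
  [FiniteDimensional ℝ F] [MeasurableSpace F] [BorelSpace F]

/-- The probability that `‖ξ + v‖²` exceeds `x`, where `ξ` is a standard Gaussian vector. In
dimension `d`, the variable `‖ξ + v‖²` has the noncentral `χ²_d` distribution with noncentrality
`‖v‖²`. -/
def noncentralChiSqTail (v : E) (x : ℝ) : ℝ := (stdGaussian E).real {y | x < ‖y + v‖ ^ 2}

lemma noncentralChiSqTail_map (L : E ≃ₗᵢ[ℝ] F) (v : E) (x : ℝ) :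
    noncentralChiSqTail (L v) x = noncentralChiSqTail v x := by
  rw [noncentralChiSqTail, noncentralChiSqTail, ← stdGaussian_map L,
    map_measureReal_apply (by fun_prop) (measurableSet_lt (by fun_prop) (by fun_prop))]
  simp only [Set.preimage_ofPred_eq, ← map_add, L.norm_map]

lemma noncentralChiSqTail_congr {v w : E} (h : ‖v‖ = ‖w‖) (x : ℝ) :
    noncentralChiSqTail v x = noncentralChiSqTail w x := by
  obtain ⟨L, rfl⟩ := exists_linearIsometryEquiv_apply_eq h
  exact (noncentralChiSqTail_map L v x).symm

end Isometry

lemma normalizedSumLaw_map_real_Ioi (μ : Measure ℝ) [IsProbabilityMeasure μ] {g : ℝ → ℝ}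
    (hg : Measurable g) (d : ℕ) (t : ℝ) :
    (normalizedSumLaw (μ.map g) d).real (Set.Ioi t) =
      (Measure.pi fun _ : Fin d => μ).real {x | t < (∑ i, g (x i)) / √d} := by
  have : IsProbabilityMeasure (μ.map g) := Measure.isProbabilityMeasure_map hg.aemeasurable
  rw [normalizedSumLaw, map_measureReal_apply (by fun_prop) measurableSet_Ioi,
    ← Measure.pi_map_pi fun _ => hg.aemeasurable,
    map_measureReal_apply (by fun_prop) (measurableSet_Ioi.preimage (by fun_prop))]
  rfl

lemma noncentralChiSqTail_const {d : ℕ} (hd : 0 < d) (m x : ℝ) :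
    noncentralChiSqTail (WithLp.toLp 2 fun _ => m : Vec d) x =
      (normalizedSumLaw (stdShiftedSqLaw m) d).real
        (Set.Ioi ((x - d * (1 + m ^ 2)) / √(d * (2 + 4 * m ^ 2)))) := by
  have hd' : (0 : ℝ) < d := by exact_mod_cast hd
  rw [stdShiftedSqLaw, normalizedSumLaw_map_real_Ioi _ (measurable_stdShiftedSq m),
    noncentralChiSqTail, ← map_pi_eq_stdGaussian,
    map_measureReal_apply (by fun_prop) (measurableSet_lt (by fun_prop) (by fun_prop))]
  refine congrArg (Measure.real _) (Set.ext fun y => ?_)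
  have hsum : (∑ i, stdShiftedSq m (y i)) / √d =
      (∑ i, (y i + m) ^ 2 - d * (1 + m ^ 2)) / √(d * (2 + 4 * m ^ 2)) := by
    rw [Real.sqrt_mul hd'.le, mul_comm (√(d : ℝ)), ← div_div]
    simp only [stdShiftedSq, ← Finset.sum_div, Finset.sum_sub_distrib, Finset.sum_const,
      Finset.card_univ, Fintype.card_fin, nsmul_eq_mul]
  simp only [Set.mem_preimage, Set.mem_ofPred_eq, EuclideanSpace.real_norm_sq_eq, PiLp.add_apply]
  rw [hsum, div_lt_div_iff_of_pos_right (by positivity), sub_lt_sub_iff_right]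

theorem eventually_abs_noncentralChiSqTail_sub_le {ε : ℝ} (hε : 0 < ε) :
    ∀ᶠ d : ℕ in Filter.atTop, ∀ (v : Vec d) (x : ℝ),
      |noncentralChiSqTail v x -
        stdNormalCdf ((d + ‖v‖ ^ 2 - x) / √(2 * d + 4 * ‖v‖ ^ 2))| ≤ ε := by
  filter_upwards [IsStandardized.eventually_abs_normalizedSumLaw_Ioi_sub_le
    (∫ x, (2 * (1 + x ^ 2)) ^ 3 ∂(gaussianReal 0 1)) hε, Filter.eventually_gt_atTop 0]
    with d hclt hd v x
  have hd' : (0 : ℝ) < d := by exact_mod_cast hd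
  set m := ‖v‖ / √(d : ℝ) with hm
  have hdm : d * m ^ 2 = ‖v‖ ^ 2 := by
    rw [hm, div_pow, Real.sq_sqrt hd'.le, mul_div_cancel₀ _ hd'.ne']
  have hnorm : ‖v‖ = ‖(WithLp.toLp 2 fun _ => m : Vec d)‖ := by
    rw [← sq_eq_sq₀ (norm_nonneg _) (norm_nonneg _), EuclideanSpace.real_norm_sq_eq
      (WithLp.toLp 2 fun _ => m : Vec d), ← hdm]
    simp
  rw [noncentralChiSqTail_congr hnorm, noncentralChiSqTail_const hd]
  convert hclt (stdShiftedSqLaw m) (isStandardized_stdShiftedSqLaw m)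
    (integral_abs_cube_stdShiftedSqLaw_le m) _ using 4
  rw [← hdm]
  ring_nf

end NoncentralChiSq

section Density

lemma lintegral_pi_prod {ι : Type*} [Fintype ι] {X : ι → Type*} [∀ i, MeasurableSpace (X i)]
    (μ : ∀ i, Measure (X i)) [∀ i, IsProbabilityMeasure (μ i)] {f : ∀ i, X i → ℝ≥0∞}
    (hf : ∀ i, Measurable (f i)) :
    ∫⁻ x, ∏ i, f i (x i) ∂(Measure.pi μ) = ∏ i, ∫⁻ x, f i x ∂(μ i) := by
  have hindep := iIndepFun_pi (μ := μ) (X := f) fun i => (hf i).aemeasurable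
  have hprod := lintegral_prod_eq_prod_lintegral_of_indepFun (μ := Measure.pi μ) Finset.univ
    (fun i x => f i (x i)) hindep fun i => (hf i).comp (measurable_pi_apply i)
  exact hprod.trans <| Finset.prod_congr rfl fun i _ =>
    (measurePreserving_eval μ i).lintegral_comp (hf i)

lemma prod_indicator_apply {ι : Type*} [Fintype ι] {X : ι → Type*} (s : ∀ i, Set (X i))
    (f : ∀ i, X i → ℝ≥0∞) (x : ∀ i, X i) :
    ∏ i, (s i).indicator (f i) (x i) =
      (Set.univ.pi s).indicator (fun x => ∏ i, f i (x i)) x := by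
  by_cases hx : x ∈ Set.univ.pi s
  · rw [Set.indicator_of_mem hx]
    exact Finset.prod_congr rfl fun i _ => Set.indicator_of_mem (hx i (Set.mem_univ i)) _
  · obtain ⟨i, hi⟩ : ∃ i, x i ∉ s i := by simpa [Set.mem_pi] using hx
    rw [Set.indicator_of_notMem hx]
    exact Finset.prod_eq_zero (Finset.mem_univ i) (Set.indicator_of_notMem hi _)

lemma pi_withDensity {ι : Type*} [Fintype ι] {X : ι → Type*} [∀ i, MeasurableSpace (X i)]
    (μ : ∀ i, Measure (X i)) [∀ i, IsProbabilityMeasure (μ i)] {f : ∀ i, X i → ℝ≥0∞}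
    (hf : ∀ i, Measurable (f i)) [∀ i, SigmaFinite ((μ i).withDensity (f i))] :
    Measure.pi (fun i => (μ i).withDensity (f i)) =
      (Measure.pi μ).withDensity fun x => ∏ i, f i (x i) := by
  refine Measure.pi_eq fun s hs => ?_
  rw [withDensity_apply _ (MeasurableSet.univ_pi hs),
    ← lintegral_indicator (MeasurableSet.univ_pi hs)]
  simp only [← prod_indicator_apply]
  rw [lintegral_pi_prod μ fun i => (hf i).indicator (hs i)]
  simp only [lintegral_indicator (hs _), withDensity_apply _ (hs _)]

lemma map_withDensity_measurableEquiv {X Y : Type*} [MeasurableSpace X] [MeasurableSpace Y]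
    (e : X ≃ᵐ Y) (μ : Measure X) (f : X → ℝ≥0∞) :
    (μ.withDensity f).map e = (μ.map e).withDensity (f ∘ e.symm) := by
  ext s hs
  rw [e.map_apply, withDensity_apply _ hs, withDensity_apply _ (e.measurable hs),
    e.measurableEmbedding.restrict_map, lintegral_map_equiv]
  simp only [Function.comp_apply, MeasurableEquiv.symm_apply_apply]

end Density

section Likelihood

/-- The likelihood ratio at `x` of the Gaussian law with mean `h` and identity covariance to the
centred one. -/
def gaussianLikelihood {E : Type*} [NormedAddCommGroup E] [InnerProductSpace ℝ E] (h x : E) :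
    ℝ≥0∞ :=
  ENNReal.ofReal (Real.exp (⟪x, h⟫ - ‖h‖ ^ 2 / 2))

@[fun_prop]
lemma measurable_gaussianLikelihood {E X : Type*} [NormedAddCommGroup E] [InnerProductSpace ℝ E]
    [MeasurableSpace E] [BorelSpace E] [SecondCountableTopology E] [MeasurableSpace X]
    {f g : X → E} (hf : Measurable f) (hg : Measurable g) :
    Measurable fun x => gaussianLikelihood (f x) (g x) := by
  unfold gaussianLikelihood
  fun_prop

lemma prod_gaussianLikelihood {ι : Type*} [Fintype ι] {E : ι → Type*}
    [∀ i, NormedAddCommGroup (E i)] [∀ i, InnerProductSpace ℝ (E i)] (h x : PiLp 2 E) :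
    ∏ i, gaussianLikelihood (h i) (x i) = gaussianLikelihood h x := by
  simp only [gaussianLikelihood]
  rw [← ENNReal.ofReal_prod_of_nonneg fun i _ => Real.exp_nonneg _, ← Real.exp_sum,
    Finset.sum_sub_distrib, ← Finset.sum_div, ← PiLp.inner_apply, ← PiLp.norm_sq_eq_of_L2]

lemma gaussianReal_eq_withDensity (h : ℝ) :
    gaussianReal h 1 = (gaussianReal 0 1).withDensity (gaussianLikelihood h) := by
  rw [gaussianReal_of_var_ne_zero h one_ne_zero, gaussianReal_of_var_ne_zero 0 one_ne_zero,
    ← withDensity_mul _ (measurable_gaussianPDF _ _) (by fun_prop)]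
  congr with x
  rw [Pi.mul_apply, gaussianPDF, gaussianPDF, gaussianLikelihood,
    ← ENNReal.ofReal_mul (gaussianPDFReal_nonneg _ _ _), gaussianPDFReal, gaussianPDFReal,
    mul_assoc _ (Real.exp _), ← Real.exp_add]
  congr 3
  simp only [sub_zero, NNReal.coe_one, mul_one, RCLike.inner_apply, conj_trivial,
    Real.norm_eq_abs, sq_abs]
  ring

variable {d : ℕ}

lemma stdGaussian_map_add_const (h : Vec d) :
    (stdGaussian (Vec d)).map (fun x => x + h) =
      (stdGaussian (Vec d)).withDensity (gaussianLikelihood h) := by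
  have hshift : (Measure.pi fun _ : Fin d => gaussianReal 0 1).map (fun x i => x i + h i) =
      Measure.pi fun i => gaussianReal (h i) 1 := by
    rw [Measure.pi_map_pi fun i => (measurable_add_const (h i)).aemeasurable]
    simp only [gaussianReal_map_add_const, zero_add]
  have hdensity : (Measure.pi fun i => gaussianReal (h i) 1) =
      (Measure.pi fun _ : Fin d => gaussianReal 0 1).withDensity
        fun x => gaussianLikelihood h (WithLp.toLp 2 x) := by
    have (i : Fin d) :
        SigmaFinite ((gaussianReal 0 1).withDensity (gaussianLikelihood (h i))) := by
      rw [← gaussianReal_eq_withDensity]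
      infer_instance
    simp only [gaussianReal_eq_withDensity (h _), ← prod_gaussianLikelihood h]
    exact pi_withDensity _ fun i => by fun_prop
  have hmap := map_withDensity_measurableEquiv (MeasurableEquiv.toLp 2 (Fin d → ℝ))
    (Measure.pi fun _ => gaussianReal 0 1) (fun x => gaussianLikelihood h (WithLp.toLp 2 x))
  rw [← hdensity, ← hshift, Measure.map_map (by fun_prop) (by fun_prop)] at hmap
  rw [← map_pi_eq_stdGaussian, Measure.map_map (by fun_prop) (by fun_prop)]
  exact hmap

end Likelihood

section SampleLaw

variable {d : ℕ} {σ : ℝ}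

lemma charFun_sphericalGaussian (m t : Vec d) : charFun (sphericalGaussian d σ m) t =
    Complex.exp (⟪t, m⟫ * Complex.I - σ ^ 2 * ‖t‖ ^ 2 / 2) := by
  have hS : (σ ^ 2 • (1 : Matrix (Fin d) (Fin d) ℝ)).PosSemidef :=
    Matrix.PosSemidef.one.smul (sq_nonneg σ)
  rw [sphericalGaussian, charFun_multivariateGaussian hS]
  congr 2
  rw [← Complex.ofReal_pow, ← Complex.ofReal_pow, EuclideanSpace.real_norm_sq_eq]
  simp only [Matrix.smul_mulVec, Matrix.one_mulVec, dotProduct, Pi.smul_apply, smul_eq_mul,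
    Complex.ofReal_sum, Complex.ofReal_mul, Complex.ofReal_pow, Finset.mul_sum]
  exact congrArg (· / 2) (Finset.sum_congr rfl fun i _ => by ring)

instance (m : Vec d) : IsProbabilityMeasure (sphericalGaussian d σ m) := by
  unfold sphericalGaussian
  infer_instance

lemma charFun_stdGaussian_map_add_const (h t : Vec d) :
    charFun ((stdGaussian (Vec d)).map fun x => x + h) t =
      Complex.exp (⟪t, h⟫ * Complex.I - ‖t‖ ^ 2 / 2) := by
  rw [charFun_map_add_const, charFun_stdGaussian, ← Complex.exp_add, real_inner_comm]
  ring_nf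

lemma sphericalGaussian_eq_map (hσ : σ ≠ 0) (m : Vec d) : sphericalGaussian d σ m =
    ((stdGaussian (Vec d)).map fun x => x + σ⁻¹ • m).map (fun x => σ • x) := by
  refine Measure.ext_of_charFun (funext fun t => ?_)
  have hinner : ⟪σ • t, σ⁻¹ • m⟫ = ⟪t, m⟫ := by
    rw [real_inner_smul_left, real_inner_smul_right, mul_inv_cancel_left₀ hσ]
  have hnorm : ‖σ • t‖ ^ 2 = σ ^ 2 * ‖t‖ ^ 2 := by
    rw [norm_smul, mul_pow, Real.norm_eq_abs, sq_abs]
  rw [charFun_map_smul, charFun_stdGaussian_map_add_const, charFun_sphericalGaussian, hinner,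
    ← Complex.ofReal_pow, ← Complex.ofReal_pow, ← Complex.ofReal_pow, hnorm, Complex.ofReal_mul]

lemma sphericalGaussian_eq_withDensity (hσ : σ ≠ 0) (m : Vec d) : sphericalGaussian d σ m =
    (sphericalGaussian d σ 0).withDensity
      fun x => gaussianLikelihood (σ⁻¹ • m) (σ⁻¹ • x) := by
  rw [sphericalGaussian_eq_map hσ, sphericalGaussian_eq_map hσ, stdGaussian_map_add_const]
  simpa [Function.comp_def] using map_withDensity_measurableEquiv (MeasurableEquiv.smul₀ σ hσ)
    (stdGaussian (Vec d)) (gaussianLikelihood (σ⁻¹ • m))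

variable {n : ℕ}

instance (p q : Vec d) : IsProbabilityMeasure (sampleLaw n d σ p q) := by
  unfold sampleLaw
  infer_instance

lemma pi_sphericalGaussian_eq_withDensity (hσ : σ ≠ 0) (m : Vec d) :
    (Measure.pi fun _ : Fin n => sphericalGaussian d σ m) =
      (Measure.pi fun _ : Fin n => sphericalGaussian d σ 0).withDensity
        fun x => ∏ i, gaussianLikelihood (σ⁻¹ • m) (σ⁻¹ • x i) := by
  have : SigmaFinite ((sphericalGaussian d σ 0).withDensity
      fun x => gaussianLikelihood (σ⁻¹ • m) (σ⁻¹ • x)) := by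
    rw [← sphericalGaussian_eq_withDensity hσ]
    infer_instance
  conv_lhs => rw [sphericalGaussian_eq_withDensity hσ]
  exact pi_withDensity (fun _ => sphericalGaussian d σ 0)
    (f := fun _ x => gaussianLikelihood (σ⁻¹ • m) (σ⁻¹ • x)) fun _ => by fun_prop

/-- The difference of the two sample sums, scaled to have identity covariance. It is a sufficient
statistic for the difference of two opposite means. -/
def stdDiff (n d : ℕ) (σ : ℝ) (z : Samples n d) : Vec d :=
  (√(2 * n) * σ)⁻¹ • (∑ i, z.1 i - ∑ i, z.2 i)

lemma measurable_stdDiff : Measurable (stdDiff n d σ) := by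
  unfold stdDiff
  fun_prop

lemma prod_gaussianLikelihood_eq_stdDiff (hn : n ≠ 0) (hσ : σ ≠ 0) (h : Vec d) (z : Samples n d) :
    (∏ i, gaussianLikelihood ((√(2 * n))⁻¹ • h) (σ⁻¹ • z.1 i)) *
      ∏ i, gaussianLikelihood (-((√(2 * n))⁻¹ • h)) (σ⁻¹ • z.2 i) =
        gaussianLikelihood h (stdDiff n d σ z) := by
  have : (0 : ℝ) < n := by exact_mod_cast Nat.pos_of_ne_zero hn
  have hsqrt : √(2 * n : ℝ) ^ 2 = 2 * n := Real.sq_sqrt (by positivity)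
  simp only [gaussianLikelihood]
  rw [← ENNReal.ofReal_prod_of_nonneg fun i _ => Real.exp_nonneg _, ← Real.exp_sum,
    ← ENNReal.ofReal_prod_of_nonneg fun i _ => Real.exp_nonneg _, ← Real.exp_sum,
    ← ENNReal.ofReal_mul (Real.exp_nonneg _), ← Real.exp_add]
  congr 2
  have hsum (x : Fin n → Vec d) : ∑ i, ⟪x i, h⟫ = ⟪∑ i, x i, h⟫ := (sum_inner _ _ _).symm
  simp only [Finset.sum_sub_distrib, stdDiff, inner_neg_right, inner_sub_left,
    real_inner_smul_left, real_inner_smul_right, Finset.sum_neg_distrib, ← Finset.mul_sum, hsum,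
    norm_neg, norm_smul, mul_pow, Finset.sum_const, Finset.card_univ, Fintype.card_fin,
    nsmul_eq_mul, norm_inv, inv_pow, Real.norm_eq_abs, sq_abs, hsqrt]
  field_simp
  ring

lemma sampleLaw_eq_withDensity (hn : n ≠ 0) (hσ : σ ≠ 0) (h : Vec d) :
    sampleLaw n d σ ((σ / √(2 * n)) • h) (-((σ / √(2 * n)) • h)) =
      (sampleLaw n d σ 0 0).withDensity fun z => gaussianLikelihood h (stdDiff n d σ z) := by
  have hscale : σ⁻¹ • (σ / √(2 * n)) • h = (√(2 * n))⁻¹ • h := by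
    rw [smul_smul, div_eq_mul_inv, inv_mul_cancel_left₀ hσ]
  have hmeas (m : Vec d) : Measurable fun x : Fin n → Vec d =>
      ∏ i, gaussianLikelihood (σ⁻¹ • m) (σ⁻¹ • x i) := by
    fun_prop
  rw [sampleLaw, pi_sphericalGaussian_eq_withDensity hσ,
    pi_sphericalGaussian_eq_withDensity hσ (-_), prod_withDensity (hmeas _) (hmeas _)]
  simp only [smul_neg, hscale, prod_gaussianLikelihood_eq_stdDiff hn hσ, sampleLaw]

lemma charFun_map_prod_sub {E X Y : Type*} [NormedAddCommGroup E] [InnerProductSpace ℝ E]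
    [MeasurableSpace E] [BorelSpace E] [SecondCountableTopology E] [MeasurableSpace X]
    [MeasurableSpace Y] (μ : Measure X) (ν : Measure Y) [SFinite μ] [SFinite ν] {f : X → E}
    {g : Y → E} (hf : Measurable f) (hg : Measurable g) (t : E) :
    charFun ((μ.prod ν).map fun z => f z.1 - g z.2) t =
      charFun (μ.map f) t * charFun (ν.map g) (-t) := by
  simp only [charFun_apply]
  rw [integral_map (by fun_prop) (by fun_prop), integral_map (by fun_prop) (by fun_prop),
    integral_map (by fun_prop) (by fun_prop), ← integral_prod_mul]
  congr with z
  rw [← Complex.exp_add, inner_sub_left, inner_neg_right]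
  push_cast
  ring_nf

lemma charFun_sampleLaw_map_sum_sub_sum (p q t : Vec d) :
    charFun ((sampleLaw n d σ p q).map fun z => ∑ i, z.1 i - ∑ i, z.2 i) t =
      Complex.exp (n * (⟪t, p - q⟫ * Complex.I - σ ^ 2 * ‖t‖ ^ 2)) := by
  rw [sampleLaw, charFun_map_prod_sub (f := fun x : Fin n → Vec d => ∑ i, x i)
      (g := fun x : Fin n → Vec d => ∑ i, x i) _ _ (by fun_prop) (by fun_prop),
    charFun_map_sum_pi_eq_prod, charFun_map_sum_pi_eq_prod]
  simp only [Finset.prod_const, Finset.card_univ, Fintype.card_fin, Pi.pow_apply,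
    charFun_sphericalGaussian, ← Complex.exp_nat_mul, ← Complex.exp_add, norm_neg, inner_neg_left,
    inner_sub_right, Complex.ofReal_sub, Complex.ofReal_neg]
  ring_nf

lemma sampleLaw_map_stdDiff (hn : n ≠ 0) (hσ : σ ≠ 0) (p q : Vec d) :
    (sampleLaw n d σ p q).map (stdDiff n d σ) =
      (stdGaussian (Vec d)).map fun x => x + (√(n / 2) / σ) • (p - q) := by
  have hn' : (0 : ℝ) < n := by exact_mod_cast Nat.pos_of_ne_zero hn
  refine Measure.ext_of_charFun (funext fun t => ?_)
  set c := (√(2 * n) * σ)⁻¹ with hc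
  have hmean : n * c = √(n / 2) / σ := by
    have hsqrt : √(2 * n : ℝ) * √(n / 2) = n := by
      rw [← Real.sqrt_mul (by positivity), show (2 * n * (n / 2) : ℝ) = n * n by ring,
        Real.sqrt_mul_self hn'.le]
    rw [hc]
    field_simp
    rw [mul_comm (n : ℝ) 2, hsqrt]
  have hinner : n * ⟪c • t, p - q⟫ = ⟪t, (√(n / 2) / σ) • (p - q)⟫ := by
    rw [real_inner_smul_left, real_inner_smul_right, ← hmean, mul_assoc]
  have hnorm : n * (σ ^ 2 * ‖c • t‖ ^ 2) = ‖t‖ ^ 2 / 2 := by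
    rw [norm_smul, mul_pow, Real.norm_eq_abs, sq_abs, hc, inv_pow, mul_pow,
      Real.sq_sqrt (by positivity)]
    field_simp
  have hcomp := Measure.map_map (μ := sampleLaw n d σ p q)
    (f := fun z => ∑ i, z.1 i - ∑ i, z.2 i) (g := fun x : Vec d => c • x)
    (by fun_prop) (by fun_prop)
  rw [show stdDiff n d σ = _ ∘ _ from rfl, ← hcomp, charFun_map_smul,
    charFun_sampleLaw_map_sum_sub_sum, charFun_stdGaussian_map_add_const]
  apply_fun ((↑) : ℝ → ℂ) at hinner hnorm
  push_cast at hinner hnorm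
  congr 1
  linear_combination Complex.I * hinner - hnorm

/-- The rejection region of the `χ²` test with critical value `x`. -/
def chiSqRegion (n d : ℕ) (σ x : ℝ) : Set (Samples n d) := {z | x < ‖stdDiff n d σ z‖ ^ 2}

lemma measurableSet_chiSqRegion (x : ℝ) : MeasurableSet (chiSqRegion n d σ x) :=
  measurableSet_lt measurable_const (measurable_stdDiff.norm.pow_const 2)

lemma sampleLaw_chiSqRegion (hn : n ≠ 0) (hσ : σ ≠ 0) (p q : Vec d) (x : ℝ) :
    (sampleLaw n d σ p q).real (chiSqRegion n d σ x) =
      noncentralChiSqTail ((√(n / 2) / σ) • (p - q)) x := by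
  have hball : MeasurableSet {s : Vec d | x < ‖s‖ ^ 2} :=
    measurableSet_lt measurable_const (by fun_prop)
  calc (sampleLaw n d σ p q).real (chiSqRegion n d σ x)
    _ = ((sampleLaw n d σ p q).map (stdDiff n d σ)).real {s | x < ‖s‖ ^ 2} :=
      (map_measureReal_apply measurable_stdDiff hball).symm
    _ = noncentralChiSqTail ((√(n / 2) / σ) • (p - q)) x := by
      rw [sampleLaw_map_stdDiff hn hσ, map_measureReal_apply (by fun_prop) hball]
      rfl

end SampleLaw

section NeymanPearson

variable {X : Type*} [MeasurableSpace X] {μ : Measure X} [IsFiniteMeasure μ]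

lemma setLIntegral_le_of_forall_notMem_le {f : X → ℝ≥0∞} {A B : Set X} (hA : MeasurableSet A)
    (hB : MeasurableSet B) (hf : ∀ x ∈ B, ∀ y ∉ B, f y ≤ f x) (hAB : μ A ≤ μ B) :
    ∫⁻ x in A, f x ∂μ ≤ ∫⁻ x in B, f x ∂μ := by
  have hdiff : μ (A \ B) ≤ μ (B \ A) := by
    rw [← measure_inter_add_sdiff A hB, ← measure_inter_add_sdiff B hA, Set.inter_comm B A] at hAB
    exact (ENNReal.add_le_add_iff_left (measure_ne_top _ _)).1 hAB
  rw [← lintegral_inter_add_sdiff f A hB, ← lintegral_inter_add_sdiff f B hA, Set.inter_comm B A]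
  refine add_le_add le_rfl ?_
  calc ∫⁻ x in A \ B, f x ∂μ
    _ ≤ ∫⁻ _ in A \ B, ⨅ y ∈ B, f y ∂μ :=
      setLIntegral_mono' (hA.diff hB) fun x hx => le_iInf₂ fun y hy => hf y hy x hx.2
    _ = (⨅ y ∈ B, f y) * μ (A \ B) := setLIntegral_const _ _
    _ ≤ (⨅ y ∈ B, f y) * μ (B \ A) := by gcongr
    _ = ∫⁻ _ in B \ A, ⨅ y ∈ B, f y ∂μ := (setLIntegral_const _ _).symm
    _ ≤ ∫⁻ x in B \ A, f x ∂μ := setLIntegral_mono' (hB.diff hA) fun x hx => iInf₂_le x hx.1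

end NeymanPearson

section InvariantPrior

variable {E : Type*} [NormedAddCommGroup E] [InnerProductSpace ℝ E] [MeasurableSpace E]

/-- Invariance of a measure under the linear isometries of the space. -/
def IsIsometryInvariant (π : Measure E) : Prop := ∀ L : E ≃ₗᵢ[ℝ] E, π.map L = π

/-- The likelihood ratio averaged over a prior on the mean: the likelihood ratio of the mixture of
the Gaussian laws to the centred one. -/
def averageLikelihood (π : Measure E) (x : E) : ℝ≥0∞ := ∫⁻ h, gaussianLikelihood h x ∂π

variable [BorelSpace E] [SecondCountableTopology E] {π : Measure E}

lemma averageLikelihood_map (hπ : IsIsometryInvariant π) (L : E ≃ₗᵢ[ℝ] E) (x : E) :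
    averageLikelihood π (L x) = averageLikelihood π x := by
  rw [averageLikelihood]
  nth_rw 1 [← hπ L]
  rw [lintegral_map (by fun_prop) (by fun_prop)]
  simp only [gaussianLikelihood, L.inner_map_map, L.norm_map, averageLikelihood]

lemma two_mul_averageLikelihood (hπ : IsIsometryInvariant π) (x : E) :
    2 * averageLikelihood π x =
      ∫⁻ h, ENNReal.ofReal (2 * Real.exp (-(‖h‖ ^ 2 / 2)) * Real.cosh ⟪x, h⟫) ∂π := by
  have hneg : averageLikelihood π (-x) = averageLikelihood π x :=
    averageLikelihood_map hπ (LinearIsometryEquiv.neg ℝ) x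
  rw [two_mul]
  nth_rw 2 [← hneg]
  rw [averageLikelihood, averageLikelihood, ← lintegral_add_left (by fun_prop)]
  refine lintegral_congr fun h => ?_
  rw [gaussianLikelihood, gaussianLikelihood,
    ← ENNReal.ofReal_add (Real.exp_nonneg _) (Real.exp_nonneg _), inner_neg_left, Real.cosh_eq,
    sub_eq_neg_add, sub_eq_neg_add, Real.exp_add, Real.exp_add]
  congr 1
  ring

/-- Since `x` may be rotated, only its length matters, and `cosh` is increasing in `|⟪x, h⟫|`. -/
lemma averageLikelihood_le_of_norm_le (hπ : IsIsometryInvariant π) {x y : E} (hxy : ‖x‖ ≤ ‖y‖) :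
    averageLikelihood π x ≤ averageLikelihood π y := by
  rcases eq_or_ne y 0 with rfl | hy
  · rw [norm_zero, norm_le_zero_iff] at hxy
    rw [hxy]
  have hy' : 0 < ‖y‖ := norm_pos_iff.2 hy
  set a := ‖x‖ / ‖y‖ with ha
  have ha0 : 0 ≤ a := by positivity
  have ha1 : |a| ≤ 1 := by
    rw [abs_of_nonneg ha0]
    exact (div_le_one hy').2 hxy
  obtain ⟨L, hL⟩ : ∃ L : E ≃ₗᵢ[ℝ] E, L (a • y) = x := exists_linearIsometryEquiv_apply_eq <| by
    rw [norm_smul, Real.norm_of_nonneg ha0, ha, div_mul_cancel₀ _ hy'.ne']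
  rw [← hL, averageLikelihood_map hπ,
    ← ENNReal.mul_le_mul_iff_right (a := 2) two_ne_zero ENNReal.ofNat_ne_top,
    two_mul_averageLikelihood hπ, two_mul_averageLikelihood hπ]
  gcongr with h
  rw [Real.cosh_le_cosh, real_inner_smul_left, abs_mul]
  exact mul_le_of_le_one_left (abs_nonneg _) ha1

variable {X : Type*} [MeasurableSpace X] {μ : Measure X} [IsFiniteMeasure μ] [SFinite π]
  {T : X → E}

lemma setLIntegral_averageLikelihood (hT : Measurable T) {A : Set X} (hA : MeasurableSet A) :
    ∫⁻ x in A, averageLikelihood π (T x) ∂μ =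
      ∫⁻ h, μ.withDensity (fun x => gaussianLikelihood h (T x)) A ∂π := by
  simp only [averageLikelihood, withDensity_apply _ hA]
  exact lintegral_lintegral_swap (measurable_gaussianLikelihood measurable_snd
    (hT.comp measurable_fst)).aemeasurable

/-- The test rejecting for large `‖T‖` is Bayes for every isometry-invariant prior on the mean of
`T`. -/
theorem lintegral_withDensity_gaussianLikelihood_le (hπ : IsIsometryInvariant π)
    (hT : Measurable T) {A : Set X} (hA : MeasurableSet A) {c : ℝ}
    (hle : μ A ≤ μ {x | c < ‖T x‖ ^ 2}) :
    ∫⁻ h, μ.withDensity (fun x => gaussianLikelihood h (T x)) A ∂π ≤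
      ∫⁻ h, μ.withDensity (fun x => gaussianLikelihood h (T x)) {x | c < ‖T x‖ ^ 2} ∂π := by
  have hB : MeasurableSet {x | c < ‖T x‖ ^ 2} := measurableSet_lt measurable_const (by fun_prop)
  rw [← setLIntegral_averageLikelihood hT hA, ← setLIntegral_averageLikelihood hT hB]
  refine setLIntegral_le_of_forall_notMem_le hA hB (fun x hx y hy => ?_) hle
  have hnorm : ‖T y‖ ^ 2 ≤ ‖T x‖ ^ 2 := (not_lt.1 hy).trans (le_of_lt hx)
  exact averageLikelihood_le_of_norm_le hπ ((sq_le_sq₀ (norm_nonneg _) (norm_nonneg _)).1 hnorm)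

end InvariantPrior

section SpherePrior

variable {E : Type*} [NormedAddCommGroup E] [InnerProductSpace ℝ E] [FiniteDimensional ℝ E]
  [MeasurableSpace E] [BorelSpace E] {r : ℝ}

/-- The uniform distribution on the sphere of radius `r`, as the law of a standard Gaussian vector
rescaled to length `r`. -/
def spherePrior (E : Type*) [NormedAddCommGroup E] [InnerProductSpace ℝ E] [FiniteDimensional ℝ E]
    [MeasurableSpace E] (r : ℝ) : Measure E :=
  (stdGaussian E).map fun g => (r * ‖g‖⁻¹) • g

instance : IsProbabilityMeasure (spherePrior E r) :=
  Measure.isProbabilityMeasure_map (by fun_prop)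

lemma isIsometryInvariant_spherePrior : IsIsometryInvariant (spherePrior E r) := by
  intro L
  have hcomm : (L ∘ fun g => (r * ‖g‖⁻¹) • g) = (fun g => (r * ‖g‖⁻¹) • g) ∘ L := by
    ext g
    simp only [Function.comp_apply, map_smul, L.norm_map]
  rw [spherePrior, Measure.map_map (by fun_prop) (by fun_prop), hcomm,
    ← Measure.map_map (by fun_prop) (by fun_prop), stdGaussian_map]

lemma ae_ne_zero_stdGaussian [Nontrivial E] : ∀ᵐ g ∂(stdGaussian E), g ≠ 0 := by
  obtain ⟨v, hv⟩ := exists_ne (0 : E)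
  have : NullSingletonClass (stdGaussian E) := by
    refine IsGaussian.nullSingletonClass fun x hx => hv ?_
    have hvar : Var[innerSL ℝ v; stdGaussian E] = 0 := by rw [hx, variance_dirac]
    rwa [variance_dual_stdGaussian, innerSL_apply_norm, sq_eq_zero_iff, norm_eq_zero] at hvar
  exact (stdGaussian E).ae_ne 0

lemma ae_norm_eq_spherePrior [Nontrivial E] (hr : 0 ≤ r) : ∀ᵐ h ∂(spherePrior E r), ‖h‖ = r := by
  rw [spherePrior, ae_map_iff (by fun_prop) (measurableSet_eq_fun (by fun_prop) (by fun_prop))]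
  filter_upwards [ae_ne_zero_stdGaussian] with g hg
  have hg' : ‖g‖ ≠ 0 := norm_ne_zero_iff.2 hg
  rw [norm_smul, norm_mul, norm_inv, norm_norm, Real.norm_of_nonneg hr,
    inv_mul_cancel_right₀ hg']

end SpherePrior

section Minimax

variable {n d : ℕ} {ρ σ a x : ℝ}

lemma rejectionProb_indicator {A : Set (Samples n d)} (hA : MeasurableSet A) (p q : Vec d) :
    rejectionProb σ (A.indicator 1) p q = (sampleLaw n d σ p q).real A :=
  integral_indicator_one hA

lemma exists_eq_indicator_of_mem_levelTests {η : Samples n d → ℝ} (hη : η ∈ levelTests n d σ a) :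
    ∃ A, MeasurableSet A ∧ η = A.indicator 1 := by
  refine ⟨η ⁻¹' {1}, hη.1 (measurableSet_singleton 1), funext fun z => ?_⟩
  rcases hη.2.1 z with h | h <;> simp [h]

lemma iInf_rejectionProb_indicator_le {A : Set (Samples n d)} (hA : MeasurableSet A)
    {θ : Vec d × Vec d} (hθ : θ ∈ alternative d ρ) :
    ⨅ θ : alternative d ρ, rejectionProb σ (A.indicator 1) θ.1.1 θ.1.2 ≤
      (sampleLaw n d σ θ.1 θ.2).real A := by
  have hbdd : BddBelow (Set.range fun θ : alternative d ρ =>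
      rejectionProb σ (A.indicator 1) θ.1.1 θ.1.2) := by
    refine ⟨0, ?_⟩
    rintro _ ⟨θ, rfl⟩
    simp only [rejectionProb_indicator hA, measureReal_nonneg]
  exact (ciInf_le hbdd ⟨θ, hθ⟩).trans_eq (rejectionProb_indicator hA _ _)

lemma nonempty_alternative [NeZero d] (hρ : 0 ≤ ρ) : (alternative d ρ).Nonempty := by
  obtain ⟨s, hs⟩ := exists_norm_eq (Vec d) hρ
  exact ⟨(s, 0), by simpa [alternative] using hs⟩

lemma sampleLaw_chiSqRegion_of_mem_alternative (hn : n ≠ 0) (hσ : 0 < σ) {v : Vec d}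
    (hv : ‖v‖ = √(n / 2) * (ρ / σ)) {θ : Vec d × Vec d} (hθ : θ ∈ alternative d ρ) (x : ℝ) :
    (sampleLaw n d σ θ.1 θ.2).real (chiSqRegion n d σ x) = noncentralChiSqTail v x := by
  rw [sampleLaw_chiSqRegion hn hσ.ne']
  refine noncentralChiSqTail_congr ?_ x
  rw [norm_smul, Real.norm_of_nonneg (by positivity), mem_sphere_zero_iff_norm.1 hθ, hv]
  ring

lemma indicator_chiSqRegion_mem_levelTests (hn : n ≠ 0) (hσ : σ ≠ 0)
    (ha : noncentralChiSqTail (0 : Vec d) x ≤ a) :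
    (chiSqRegion n d σ x).indicator 1 ∈ levelTests n d σ a := by
  have hmeas := measurableSet_chiSqRegion (n := n) (d := d) (σ := σ) x
  refine ⟨measurable_one.indicator hmeas, fun z => ?_, fun m => ?_⟩
  · exact (Set.indicator_eq_zero_or_self _ _ z)
  · rwa [rejectionProb_indicator hmeas, sampleLaw_chiSqRegion hn hσ, sub_self, smul_zero]

lemma noncentralChiSqTail_le_minimaxPower [NeZero d] (hn : n ≠ 0) (hσ : 0 < σ) (hρ : 0 ≤ ρ)
    {v : Vec d} (hv : ‖v‖ = √(n / 2) * (ρ / σ)) (ha : noncentralChiSqTail (0 : Vec d) x ≤ a) :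
    noncentralChiSqTail v x ≤ minimaxPower n d ρ a σ := by
  obtain ⟨θ₀, hθ₀⟩ := nonempty_alternative (d := d) hρ
  have : Nonempty (alternative d ρ) := ⟨⟨θ₀, hθ₀⟩⟩
  have hbdd : BddAbove (Set.range fun η : levelTests n d σ a =>
      ⨅ θ : alternative d ρ, rejectionProb σ η.1 θ.1.1 θ.1.2) := by
    refine ⟨1, ?_⟩
    rintro _ ⟨⟨η, hη⟩, rfl⟩
    obtain ⟨A, hA, rfl⟩ := exists_eq_indicator_of_mem_levelTests hη
    exact (iInf_rejectionProb_indicator_le hA hθ₀).trans measureReal_le_one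
  refine le_trans (le_ciInf fun θ => ?_)
    (le_ciSup hbdd ⟨_, indicator_chiSqRegion_mem_levelTests hn hσ.ne' ha⟩)
  rw [rejectionProb_indicator (measurableSet_chiSqRegion x),
    sampleLaw_chiSqRegion_of_mem_alternative hn hσ hv θ.2]

lemma opposite_means_mem_alternative (hn : n ≠ 0) (hσ : 0 < σ) {h : Vec d}
    (hh : ‖h‖ = √(n / 2) * (ρ / σ)) :
    ((σ / √(2 * n)) • h, -((σ / √(2 * n)) • h)) ∈ alternative d ρ := by
  have : (0 : ℝ) < n := by exact_mod_cast Nat.pos_of_ne_zero hn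
  have hsqrt : √(2 * n : ℝ) = 2 * √(n / 2) := by
    rw [show (2 * n : ℝ) = 2 ^ 2 * (n / 2) by ring, Real.sqrt_mul (by positivity),
      Real.sqrt_sq zero_le_two]
  rw [alternative, Set.mem_ofPred_eq, mem_sphere_zero_iff_norm, sub_neg_eq_add, ← two_smul ℝ,
    norm_smul, norm_smul, hh, Real.norm_of_nonneg zero_le_two, Real.norm_of_nonneg (by positivity),
    hsqrt]
  field_simp

/-- The smallest power is at most the average power over the spherical prior, on which the `χ²`
test is optimal. -/
lemma iInf_rejectionProb_indicator_le_noncentralChiSqTail [NeZero d] (hn : n ≠ 0) (hσ : 0 < σ)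
    {v : Vec d} (hv : ‖v‖ = √(n / 2) * (ρ / σ)) {A : Set (Samples n d)} (hA : MeasurableSet A)
    (hnull : sampleLaw n d σ 0 0 A ≤ sampleLaw n d σ 0 0 (chiSqRegion n d σ x)) :
    ⨅ θ : alternative d ρ, rejectionProb σ (A.indicator 1) θ.1.1 θ.1.2 ≤
      noncentralChiSqTail v x := by
  set b := ⨅ θ : alternative d ρ, rejectionProb σ (A.indicator 1) θ.1.1 θ.1.2
  set mean : Vec d → Vec d := fun h => (σ / √(2 * n)) • h
  have hprior : ∀ᵐ h ∂(spherePrior (Vec d) ‖v‖), (mean h, -mean h) ∈ alternative d ρ := by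
    filter_upwards [ae_norm_eq_spherePrior (norm_nonneg v)] with h hh
    exact opposite_means_mem_alternative hn hσ (hh.trans hv)
  have hbayes := lintegral_withDensity_gaussianLikelihood_le
    (isIsometryInvariant_spherePrior (E := Vec d) (r := ‖v‖)) measurable_stdDiff hA hnull
  simp only [← sampleLaw_eq_withDensity hn hσ.ne'] at hbayes
  refine (ENNReal.ofReal_le_ofReal_iff (q := noncentralChiSqTail v x) measureReal_nonneg).1 ?_
  calc ENNReal.ofReal b
    _ = ∫⁻ _, ENNReal.ofReal b ∂(spherePrior (Vec d) ‖v‖) := by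
      rw [lintegral_const, measure_univ, mul_one]
    _ ≤ ∫⁻ h, sampleLaw n d σ (mean h) (-mean h) A ∂(spherePrior (Vec d) ‖v‖) := by
      refine lintegral_mono_ae (hprior.mono fun h hh => ?_)
      exact ENNReal.ofReal_le_of_le_toReal (iInf_rejectionProb_indicator_le hA hh)
    _ ≤ ∫⁻ h, sampleLaw n d σ (mean h) (-mean h) (chiSqRegion n d σ x)
        ∂(spherePrior (Vec d) ‖v‖) := hbayes
    _ = ∫⁻ _, ENNReal.ofReal (noncentralChiSqTail v x) ∂(spherePrior (Vec d) ‖v‖) := by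
      refine lintegral_congr_ae (hprior.mono fun h hh => ?_)
      rw [← sampleLaw_chiSqRegion_of_mem_alternative hn hσ hv hh x]
      exact ofReal_measureReal (measure_ne_top _ _) |>.symm
    _ = ENNReal.ofReal (noncentralChiSqTail v x) := by
      rw [lintegral_const, measure_univ, mul_one]

lemma minimaxPower_le_noncentralChiSqTail [NeZero d] (hn : n ≠ 0) (hσ : 0 < σ) {v : Vec d}
    (hv : ‖v‖ = √(n / 2) * (ρ / σ)) (ha : a ≤ noncentralChiSqTail (0 : Vec d) x) :
    minimaxPower n d ρ a σ ≤ noncentralChiSqTail v x := by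
  refine Real.iSup_le (fun ⟨η, hη⟩ => ?_) measureReal_nonneg
  obtain ⟨A, hA, rfl⟩ := exists_eq_indicator_of_mem_levelTests hη
  have hlevel : (sampleLaw n d σ 0 0).real A ≤ a :=
    (rejectionProb_indicator hA 0 0).symm.trans_le (hη.2.2 0)
  refine iInf_rejectionProb_indicator_le_noncentralChiSqTail hn hσ hv hA ?_
  rw [← ENNReal.toReal_le_toReal (measure_ne_top _ _) (measure_ne_top _ _)]
  refine (hlevel.trans ha).trans_eq ?_
  rw [← measureReal_def, sampleLaw_chiSqRegion hn hσ.ne', sub_self, smul_zero]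

end Minimax

section Asymptotics

open Filter

lemma limitPower_eq {n d : ℕ} (hn : n ≠ 0) (hd : d ≠ 0) (α Ψ : ℝ) : limitPower n d α Ψ =
    stdNormalCdf ((n / 2 * Ψ ^ 2 - √(2 * d) * upperQuantile α) /
      √(2 * d + 4 * (n / 2 * Ψ ^ 2))) := by
  have : (0 : ℝ) < n := by exact_mod_cast Nat.pos_of_ne_zero hn
  have : (0 : ℝ) < d := by exact_mod_cast Nat.pos_of_ne_zero hd
  have hscale : 8 * (d : ℝ) / n ^ 2 + 8 * Ψ ^ 2 / n = (2 / n) ^ 2 * (2 * (d + n * Ψ ^ 2)) := by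
    field_simp
    ring
  have hvar : 2 * d + 4 * (n / 2 * Ψ ^ 2) = 2 * (d + n * Ψ ^ 2) := by ring
  rw [limitPower, hscale, hvar, Real.sqrt_mul (by positivity), Real.sqrt_sq (by positivity),
    Real.sqrt_mul zero_le_two, Real.sqrt_mul zero_le_two]
  congr 1
  have : 0 < √((d : ℝ) + n * Ψ ^ 2) := by positivity
  field_simp
  ring

lemma eventually_abs_noncentralChiSqTail_zero_sub_le {ε : ℝ} (hε : 0 < ε) :
    ∀ᶠ d : ℕ in atTop, ∀ u : ℝ,
      |noncentralChiSqTail (0 : Vec d) (d + √(2 * d) * u) - stdNormalCdf (-u)| ≤ ε := by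
  filter_upwards [eventually_abs_noncentralChiSqTail_sub_le hε, eventually_gt_atTop 0]
    with d hclt hd u
  have : (0 : ℝ) < d := by exact_mod_cast hd
  have hstd : ((d : ℝ) + ‖(0 : Vec d)‖ ^ 2 - (d + √(2 * d) * u)) /
      √(2 * d + 4 * ‖(0 : Vec d)‖ ^ 2) = -u := by
    rw [norm_zero, zero_pow two_ne_zero, mul_zero, add_zero, add_zero]
    field_simp
    ring
  simpa only [hstd] using hclt 0 (d + √(2 * d) * u)

lemma eventually_abs_noncentralChiSqTail_sub_limitPower_le {ε : ℝ} (hε : 0 < ε) (α : ℝ) :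
    ∀ᶠ d : ℕ in atTop, ∀ n : ℕ, n ≠ 0 → ∀ (Ψ u : ℝ) (v : Vec d), ‖v‖ = √(n / 2) * Ψ →
      |noncentralChiSqTail v (d + √(2 * d) * u) - limitPower n d α Ψ| ≤
        ε + |u - upperQuantile α| := by
  filter_upwards [eventually_abs_noncentralChiSqTail_sub_le hε, eventually_gt_atTop 0]
    with d hclt hd n hn Ψ u v hv
  have : (0 : ℝ) < d := by exact_mod_cast hd
  have hv' : n / 2 * Ψ ^ 2 = ‖v‖ ^ 2 := by rw [hv, mul_pow, Real.sq_sqrt (by positivity)]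
  set s := √(2 * d + 4 * ‖v‖ ^ 2) with hs
  have hs0 : 0 < s := by positivity
  have hsd : √(2 * (d : ℝ)) ≤ s := Real.sqrt_le_sqrt (by linarith [sq_nonneg ‖v‖])
  rw [limitPower_eq hn hd.ne', hv', ← hs]
  refine (abs_sub_le _ _ _).trans (add_le_add (hclt v _) ?_)
  refine (lipschitzWith_stdNormalCdf.dist_le_mul _ _).trans ?_
  rw [NNReal.coe_one, one_mul, Real.dist_eq, ← hs, ← sub_div, abs_div, abs_of_pos hs0,
    div_le_iff₀ hs0]
  calc |d + ‖v‖ ^ 2 - (d + √(2 * d) * u) - (‖v‖ ^ 2 - √(2 * d) * upperQuantile α)|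
    _ = |u - upperQuantile α| * √(2 * d) := by
      rw [← abs_of_nonneg (Real.sqrt_nonneg (2 * d)), ← abs_mul, ← abs_neg,
        abs_of_nonneg (Real.sqrt_nonneg _)]
      ring_nf
    _ ≤ |u - upperQuantile α| * s := by gcongr

lemma exists_stdNormalCdf_neg_add_le {α τ : ℝ} (hα0 : 0 < α) (hα1 : α < 1) (hτ : 0 < τ) :
    ∃ κ > 0, stdNormalCdf (-(upperQuantile α + τ)) + κ ≤ α ∧
      α + κ ≤ stdNormalCdf (-(upperQuantile α - τ)) := by
  have hquantile : stdNormalCdf (-upperQuantile α) = α := by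
    rw [stdNormalCdf_neg, stdNormalCdf_upperQuantile hα0 hα1, sub_sub_cancel]
  have hlo : stdNormalCdf (-(upperQuantile α + τ)) < α :=
    (strictMono_stdNormalCdf (neg_lt_neg (lt_add_of_pos_right _ hτ))).trans_eq hquantile
  have hhi : α < stdNormalCdf (-(upperQuantile α - τ)) :=
    hquantile.symm.trans_lt (strictMono_stdNormalCdf (neg_lt_neg (sub_lt_self _ hτ)))
  exact ⟨min (α - stdNormalCdf (-(upperQuantile α + τ)))
    (stdNormalCdf (-(upperQuantile α - τ)) - α), lt_min (sub_pos.2 hlo) (sub_pos.2 hhi),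
    add_le_of_le_sub_left (min_le_left _ _), add_le_of_le_sub_left (min_le_right _ _)⟩

end Asymptotics

end MeanTest

end

/-- The error is `o(1)` as `d → ∞`, uniformly in `n ≥ 1`, `ρ ≥ 0`, `σ > 0`. The level `a` of the
tests may differ from `α` by a small amount, so that tests of level `α + o(1)` are covered along
with those of level exactly `α`. -/
theorem mainTheorem3 (α : ℝ) (hα0 : 0 < α) (hα1 : α < 1) :
    ∀ ε : ℝ, 0 < ε → ∃ κ : ℝ, 0 < κ ∧ ∃ D : ℕ, ∀ d : ℕ, D ≤ d →
      ∀ n : ℕ, 1 ≤ n → ∀ ρ σ a : ℝ, 0 ≤ ρ → 0 < σ → |a - α| ≤ κ →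
        |MeanTest.minimaxPower n d ρ a σ - MeanTest.limitPower n d α (ρ / σ)| ≤ ε := by
  open MeanTest in
  intro ε hε
  set z := upperQuantile α
  obtain ⟨κ, hκ, hlo, hhi⟩ := exists_stdNormalCdf_neg_add_le hα0 hα1 (half_pos hε)
  obtain ⟨D, hD⟩ := Filter.eventually_atTop.1 <|
    (eventually_abs_noncentralChiSqTail_zero_sub_le (half_pos hκ)).and <|
    (eventually_abs_noncentralChiSqTail_sub_limitPower_le (half_pos hε) α).and <|
    Filter.eventually_ne_atTop 0
  refine ⟨κ / 2, half_pos hκ, D, fun d hd n hn ρ σ a hρ hσ ha => ?_⟩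
  obtain ⟨hlevel, hpower, hd0⟩ := hD d hd
  have : NeZero d := ⟨hd0⟩
  have hn0 : n ≠ 0 := Nat.one_le_iff_ne_zero.1 hn
  obtain ⟨v, hv⟩ := exists_norm_eq (Vec d) (c := √(n / 2) * (ρ / σ)) (by positivity)
  have hlower := noncentralChiSqTail_le_minimaxPower (a := a) (x := d + √(2 * d) * (z + ε / 2))
    hn0 hσ hρ hv (by linarith [abs_le.1 ha, abs_le.1 (hlevel (z + ε / 2))])
  have hupper := minimaxPower_le_noncentralChiSqTail (a := a) (x := d + √(2 * d) * (z - ε / 2))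
    hn0 hσ hv (by linarith [abs_le.1 ha, abs_le.1 (hlevel (z - ε / 2))])
  have hpower_lower := hpower n hn0 _ (z + ε / 2) v hv
  have hpower_upper := hpower n hn0 _ (z - ε / 2) v hv
  rw [add_sub_cancel_left, abs_of_pos (half_pos hε)] at hpower_lower
  rw [sub_sub_cancel_left, abs_neg, abs_of_pos (half_pos hε)] at hpower_upper
  exact abs_le.2 ⟨by linarith [abs_le.1 hpower_lower], by linarith [abs_le.1 hpower_upper]⟩
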